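/- Let $\eta=(\eta^{ij})$ ($N\times N$) and $\mu=(\mu^{mn})$ ($L\times L$) be constant nondegenerate symmetric real matrices, $(\eta_{ij})=(\eta^{ij})^{-1}$, and let $\psi_1,\dots,\psi_L$ be smooth functions on an open set $U\subseteq\mathbb R^N$ with coordinates $u=(u^1,\dots,u^N)$. Write $\partial_i=\partial/\partial u^i$; repeated indices are summed. Suppose that on $U$ $$\eta^{mn}\,\partial_i\partial_m\psi_j\,\partial_n\partial_l\psi_k=\eta^{mn}\,\partial_i\partial_m\psi_k\,\partial_n\partial_l\psi_j,\qquad \mu^{mn}\,\partial_i\partial_j\psi_m\,\partial_k\partial_l\psi_n=\mu^{mn}\,\partial_i\partial_k\psi_m\,\partial_j\partial_l\psi_n$$ for all values of the free indices. Consider the operators on fields $u(x)$ $$M_1^{ij}=\mu^{mn}\eta^{ip}\eta^{jr}\,\partial_p\partial_k\psi_m\,u^k_x\Big(\frac{d}{dx}\Big)^{-1}\!\circ\,\partial_r\partial_s\psi_n\,u^s_x,\qquad M_2^{ij}=\eta^{ij}\frac{d}{dx},\qquad R=M_1M_2^{-1}.$$ 1. $M_1$ and $M_2$ are compatible Hamiltonian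 operators: for all constants $a,b\in\mathbb R$ the operator $aM_1+bM_2$ (with $(d/dx)^{-1}=\frac12(\int_{-\infty}^x-\int_x^\infty)$ on compactly supported functions) defines, on smooth fields with values in $U$, a skew-symmetric bracket satisfying the Jacobi identity. Let moreover $V\subseteq U$ be any convex open set (every point of $U$ has such a neighbourhood). On $V$ consider, for smooth functions and starting from $h_1=\frac12\eta_{ij}u^iu^j$, the recursion relations for $s\ge1$ $$\partial_j\partial_p\psi_n\,\eta^{jr}\,\partial_r h_s=\partial_pF_n^{(s)}\quad(1\le n\le L),\qquad \mu^{mn}\,\partial_j\partial_k\psi_m\,F_n^{(s)}=\partial_j\partial_k h_{s+1}.$$ 2. The recursion is solvable on $V$ for every $s\ge1$: for every choice of the functions $F^{(1)}_n,h_2,\dots,F^{(s-1)}_n,h_s$ made in the preceding steps there are $F^{(s)}_n$ satisfying the first relation, and for every such $F^{(s)}_n$ there is $h_{s+1}$ satisfying the second. In particular solutions defined for all $s\ge 1$ exist. 3. Call an expression in the field local if it is a smooth function of $u\in V$ and finitely many $x$-derivatives of $u$, and let $(d/dx)^{-1}$ be taken in the class of local expressions, up to constants of integration. For every $s\ge0$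 the expression $R^su_x$ exists as a local expression, and for any choice of the integration constants it is of hydrodynamic type, $(R^su_x)^i=A^i_k(u)u^k_x$ with $A$ smooth on $V$, and $R$ can be applied to it again. 4. For every solution $(F_n^{(s)},h_s)_{s\ge1}$ of the recursion put $H_s=\int h_s(u)\,dx$, so that $\delta H_s/\delta u^j=\partial_jh_s$. Then for every $s\ge1$ the system of hydrodynamic type $$u^i_{t_s}=\mu^{mn}\eta^{ip}F_n^{(s)}(u)\,\partial_p\partial_k\psi_m\,u^k_x$$ is $u_{t_s}=R^su_x$ and is bi-Hamiltonian: $u^i_{t_s}=M_1^{ij}\,\delta H_s/\delta u^j=M_2^{ij}\,\delta H_{s+1}/\delta u^j$. These flows commute pairwise, and $\{H_p,H_r\}_1=\{H_p,H_r\}_2=0$ for all $p,r\ge1$, where $\{H,G\}_a=\int \frac{\delta H}{\delta u^i}M_a^{ij}\frac{\delta G}{\delta u^j}\,dx$ and an integral $\int q\,dx$ is zero when $q$ is the $x$-derivative of a local expression. -/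

import Mathlib

open scoped ContDiff

noncomputable section

namespace HydroHierarchy

/-- The space with flat coordinates `u = (u¹, …, u^N)`. -/
abbrev Coord (N : ℕ) : Type := Fin N → ℝ

/-- Expressions in a field `u = u(x)`: a `W`-valued function of `x` for each `u : ℝ → ℝ^N`. -/
abbrev FieldFun (N : ℕ) (W : Type) : Type := (ℝ → Coord N) → ℝ → W

/-- The partial derivative `∂f/∂u^i`. -/
def pd {N : ℕ} (i : Fin N) (f : Coord N → ℝ) : Coord N → ℝ :=
  fun u => fderiv ℝ f u (Pi.single i 1)

/-- The second partial derivative `∂²f/∂u^i∂u^j`. -/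
def pd2 {N : ℕ} (i j : Fin N) (f : Coord N → ℝ) : Coord N → ℝ :=
  pd i (pd j f)

/-- A smooth field `x ↦ u(x)` with values in `V`. -/
def IsField {N : ℕ} (V : Set (Coord N)) (u : ℝ → Coord N) : Prop :=
  ContDiff ℝ ∞ u ∧ ∀ x, u x ∈ V

/-! ### The nonlinear equations for the potentials `ψ_n` -/

/-- `η^{mn} ∂_i∂_mψ_j ∂_n∂_lψ_k = η^{mn} ∂_i∂_mψ_k ∂_n∂_lψ_j` on `U`. -/
def CommutingHessians {N L : ℕ} (U : Set (Coord N)) (η : Matrix (Fin N) (Fin N) ℝ)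
    (ψ : Fin L → Coord N → ℝ) : Prop :=
  ∀ u ∈ U, ∀ (j k : Fin L) (i l : Fin N),
    ∑ m, ∑ n, η m n * pd2 i m (ψ j) u * pd2 n l (ψ k) u =
      ∑ m, ∑ n, η m n * pd2 i m (ψ k) u * pd2 n l (ψ j) u

/-- `μ^{mn} ∂_i∂_jψ_m ∂_k∂_lψ_n = μ^{mn} ∂_i∂_kψ_m ∂_j∂_lψ_n` on `U`. -/
def GaussEquations {N L : ℕ} (U : Set (Coord N)) (μ : Matrix (Fin L) (Fin L) ℝ)
    (ψ : Fin L → Coord N → ℝ) : Prop :=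
  ∀ u ∈ U, ∀ i j k l : Fin N,
    ∑ m, ∑ n, μ m n * pd2 i j (ψ m) u * pd2 k l (ψ n) u =
      ∑ m, ∑ n, μ m n * pd2 i k (ψ m) u * pd2 j l (ψ n) u

/-! ### The recursion for the functions `F_n^{(s)}` and the densities `h_s` -/

/-- `F_n`, smooth on `V`, solve `∂_j∂_pψ_n η^{jr} ∂_r h = ∂_p F_n` on `V`. -/
def SolvesF {N L : ℕ} (V : Set (Coord N)) (η : Matrix (Fin N) (Fin N) ℝ)
    (ψ : Fin L → Coord N → ℝ) (h : Coord N → ℝ) (F : Fin L → Coord N → ℝ) : Prop :=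
  (∀ n, ContDiffOn ℝ ∞ (F n) V) ∧
  ∀ u ∈ V, ∀ (n : Fin L) (p : Fin N),
    ∑ j, ∑ r, pd2 j p (ψ n) u * η j r * pd r h u = pd p (F n) u

/-- `h'`, smooth on `V`, solves `μ^{mn} ∂_j∂_kψ_m F_n = ∂_j∂_k h'` on `V`. -/
def SolvesH {N L : ℕ} (V : Set (Coord N)) (μ : Matrix (Fin L) (Fin L) ℝ)
    (ψ : Fin L → Coord N → ℝ) (F : Fin L → Coord N → ℝ) (h' : Coord N → ℝ) : Prop :=
  ContDiffOn ℝ ∞ h' V ∧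
  ∀ u ∈ V, ∀ j k : Fin N,
    ∑ m, ∑ n, μ m n * pd2 j k (ψ m) u * F n u = pd2 j k h' u

/-- `F^{(1)}, …, F^{(K)}` and `h_1, …, h_{K+1}` satisfy the recursion on `V`, where
`h_1 = ½ η_{ij} u^i u^j` and `(η_{ij})` is the inverse of `(η^{ij})`.
Values `F 0` and `h 0` play no role. -/
def SolvesUpTo {N L : ℕ} (V : Set (Coord N)) (η : Matrix (Fin N) (Fin N) ℝ)
    (μ : Matrix (Fin L) (Fin L) ℝ) (ψ : Fin L → Coord N → ℝ) (K : ℕ)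
    (F : ℕ → Fin L → Coord N → ℝ) (h : ℕ → Coord N → ℝ) : Prop :=
  (∀ u ∈ V, h 1 u = (1 / 2) * ∑ i, ∑ j, η⁻¹ i j * u i * u j) ∧
  ∀ s, 1 ≤ s → s ≤ K → SolvesF V η ψ (h s) (F s) ∧ SolvesH V μ ψ (F s) (h (s + 1))

/-- The whole infinite recursion, for all `s ≥ 1`. -/
def SolvesRecursion {N L : ℕ} (V : Set (Coord N)) (η : Matrix (Fin N) (Fin N) ℝ)
    (μ : Matrix (Fin L) (Fin L) ℝ) (ψ : Fin L → Coord N → ℝ)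
    (F : ℕ → Fin L → Coord N → ℝ) (h : ℕ → Coord N → ℝ) : Prop :=
  ∀ K, SolvesUpTo V η μ ψ K F h

/-! ### Local expressions (differential functions) and the formal `d/dx` -/

/-- `P[u](x) = f(u(x), u_x(x), …, u^{(k)}(x))` for some finite `k` and some smooth `f`, on all
fields with values in `V`. -/
def IsLocal {N : ℕ} {W : Type} [NormedAddCommGroup W] [NormedSpace ℝ W]
    (V : Set (Coord N)) (P : FieldFun N W) : Prop :=
  ∃ (k : ℕ) (f : (Fin (k + 1) → Coord N) → W),
    ContDiffOn ℝ ∞ f {J | J 0 ∈ V} ∧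
    ∀ u, IsField V u → ∀ x, P u x = f (fun a => iteratedDeriv (a : ℕ) u x)

/-- `(d/dx) Q = P` on all fields with values in `V`. -/
def IsTotalDeriv {N : ℕ} {W : Type} [NormedAddCommGroup W] [NormedSpace ℝ W]
    (V : Set (Coord N)) (Q P : FieldFun N W) : Prop :=
  ∀ u, IsField V u → ∀ x, HasDerivAt (Q u) (P u x) x

/-- `Q` is a value of `(d/dx)⁻¹ P` in the class of local expressions (it is determined by `P`
only up to an integration constant). -/
def IsInvDx {N : ℕ} {W : Type} [NormedAddCommGroup W] [NormedSpace ℝ W]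
    (V : Set (Coord N)) (P Q : FieldFun N W) : Prop :=
  IsLocal V Q ∧ IsTotalDeriv V Q P

/-- The functional `∫ q dx` vanishes: `q` is the total `x`-derivative of a local expression. -/
def IsNullDensity {N : ℕ} (V : Set (Coord N)) (q : FieldFun N ℝ) : Prop :=
  ∃ Q : FieldFun N ℝ, IsInvDx V q Q

/-- A local expression of hydrodynamic type, `Y^i = A^i_k(u) u^k_x`, with `A` smooth on `V`. -/
def IsHydrodynamic {N : ℕ} (V : Set (Coord N)) (Y : FieldFun N (Coord N)) : Prop :=
  ∃ A : Fin N → Fin N → Coord N → ℝ,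
    (∀ i k, ContDiffOn ℝ ∞ (A i k) V) ∧
    ∀ u, IsField V u → ∀ x i, Y u x i = ∑ k, A i k (u x) * deriv u x k

/-- The variational derivative `δH/δu^j = ∂h/∂u^j` of `H = ∫ h(u) dx`
(the density `h` does not involve derivatives of `u`). -/
def varDeriv {N : ℕ} (h : Coord N → ℝ) : FieldFun N (Coord N) :=
  fun u x j => pd j h (u x)

/-! ### The operators `M₁`, `M₂`, and the recursion operator `R = M₁ M₂⁻¹`

`M₁^{ij} = μ^{mn} η^{ip} η^{jr} ∂_p∂_kψ_m u^k_x (d/dx)⁻¹ ∘ ∂_r∂_sψ_n u^s_x` and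
`M₂^{ij} = η^{ij} d/dx`. -/

/-- The right factor of `M₁`: `η^{jr} ∂_r∂_sψ_n u^s_x ξ_j`. -/
def rightFactor {N L : ℕ} (η : Matrix (Fin N) (Fin N) ℝ) (ψ : Fin L → Coord N → ℝ)
    (u ξ : ℝ → Coord N) (n : Fin L) (x : ℝ) : ℝ :=
  ∑ j, ∑ r, ∑ s, η j r * pd2 r s (ψ n) (u x) * deriv u x s * ξ x j

/-- The left factor of `M₁`: `μ^{mn} η^{ip} ∂_p∂_kψ_m u^k_x P_n`. -/
def leftFactor {N L : ℕ} (η : Matrix (Fin N) (Fin N) ℝ) (μ : Matrix (Fin L) (Fin L) ℝ)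
    (ψ : Fin L → Coord N → ℝ) (u : ℝ → Coord N) (P : Fin L → ℝ → ℝ) (x : ℝ) : Coord N :=
  fun i => ∑ m, ∑ n, ∑ p, ∑ k, μ m n * η i p * pd2 p k (ψ m) (u x) * deriv u x k * P n x

/-- `Y` is a (local) value of `M₁ G`. -/
def IsM1Value {N L : ℕ} (V : Set (Coord N)) (η : Matrix (Fin N) (Fin N) ℝ)
    (μ : Matrix (Fin L) (Fin L) ℝ) (ψ : Fin L → Coord N → ℝ)
    (G Y : FieldFun N (Coord N)) : Prop :=
  ∃ P : Fin L → FieldFun N ℝ,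
    (∀ n, IsInvDx V (fun u x => rightFactor η ψ u (G u) n x) (P n)) ∧
    ∀ u, IsField V u → ∀ x, Y u x = leftFactor η μ ψ u (fun n => P n u) x

/-- `Y = M₂ G`. -/
def IsM2Value {N : ℕ} (V : Set (Coord N)) (η : Matrix (Fin N) (Fin N) ℝ)
    (G Y : FieldFun N (Coord N)) : Prop :=
  IsTotalDeriv V (fun u x => η.mulVec (G u x)) Y

/-- `Y'` is a (local) value of `R Y = M₁ M₂⁻¹ Y`. -/
def IsRValue {N L : ℕ} (V : Set (Coord N)) (η : Matrix (Fin N) (Fin N) ℝ)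
    (μ : Matrix (Fin L) (Fin L) ℝ) (ψ : Fin L → Coord N → ℝ)
    (Y Y' : FieldFun N (Coord N)) : Prop :=
  ∃ G : FieldFun N (Coord N), IsLocal V G ∧ IsM2Value V η G Y ∧ IsM1Value V η μ ψ G Y'

/-- `Y` is a (local) value of `R^s u_x`. -/
def IsRPowValue {N L : ℕ} (V : Set (Coord N)) (η : Matrix (Fin N) (Fin N) ℝ)
    (μ : Matrix (Fin L) (Fin L) ℝ) (ψ : Fin L → Coord N → ℝ) :
    ℕ → FieldFun N (Coord N) → Prop
  | 0, Y => ∀ u, IsField V u → ∀ x, Y u x = deriv u x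
  | s + 1, Y => ∃ Y', IsRPowValue V η μ ψ s Y' ∧ IsRValue V η μ ψ Y' Y

/-- The right-hand side `μ^{mn} η^{ip} F_n(u) ∂_p∂_kψ_m u^k_x` of a flow of the hierarchy. -/
def flow {N L : ℕ} (η : Matrix (Fin N) (Fin N) ℝ) (μ : Matrix (Fin L) (Fin L) ℝ)
    (ψ : Fin L → Coord N → ℝ) (F : Fin L → Coord N → ℝ) : FieldFun N (Coord N) :=
  fun u x i =>
    ∑ m, ∑ n, ∑ p, ∑ k, μ m n * η i p * F n (u x) * pd2 p k (ψ m) (u x) * deriv u x k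

/-- `{∫ h dx, ∫ g dx} = ∫ (δH/δu^i) M^{ij} (δG/δu^j) dx = 0`, where `M` is given by its graph:
`M δG` has a local value, and every such value gives the zero functional. -/
def InInvolution {N : ℕ} (V : Set (Coord N))
    (M : FieldFun N (Coord N) → FieldFun N (Coord N) → Prop) (h g : Coord N → ℝ) : Prop :=
  (∃ Y, M (varDeriv g) Y) ∧
  ∀ Y, M (varDeriv g) Y → IsNullDensity V (fun u x => ∑ i, varDeriv h u x i * Y u x i)

/-- The flows `u_t = Y[u]` and `u_τ = Z[u]` commute: the derivative of `Y` along `Z` equals the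
derivative of `Z` along `Y`. -/
def FlowsCommute {N : ℕ} (V : Set (Coord N)) (Y Z : FieldFun N (Coord N)) : Prop :=
  ∀ u, IsField V u → ∀ x, ∃ d : Coord N,
    HasDerivAt (fun ε : ℝ => Y (u + ε • Z u) x) d 0 ∧
    HasDerivAt (fun ε : ℝ => Z (u + ε • Y u) x) d 0

/-! ### Hamiltonian operators -/

/-- A smooth compactly supported covector field along the `x`-axis. -/
def IsTest {N : ℕ} (ξ : ℝ → Coord N) : Prop :=
  ContDiff ℝ ∞ ξ ∧ HasCompactSupport ξ

/-- `∫ ξ_i(x) v^i(x) dx`. -/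
def pairing {N : ℕ} (ξ v : ℝ → Coord N) : ℝ :=
  ∫ x, ∑ i, ξ x i * v x i

/-- The skew-symmetric antiderivative `½ (∫_{-∞}^x - ∫_x^∞)` of compactly supported functions. -/
def skewInt (f : ℝ → ℝ) (x : ℝ) : ℝ :=
  (1 / 2) * ((∫ y in Set.Iic x, f y) - ∫ y in Set.Ioi x, f y)

/-- `M₁` at the field `u`, applied to a test covector field. -/
def M1op {N L : ℕ} (η : Matrix (Fin N) (Fin N) ℝ) (μ : Matrix (Fin L) (Fin L) ℝ)
    (ψ : Fin L → Coord N → ℝ) (u ξ : ℝ → Coord N) : ℝ → Coord N :=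
  leftFactor η μ ψ u (fun n => skewInt (rightFactor η ψ u ξ n))

/-- `M₂` (which does not depend on the field), applied to a test covector field. -/
def M2op {N : ℕ} (η : Matrix (Fin N) (Fin N) ℝ) (ξ : ℝ → Coord N) : ℝ → Coord N :=
  fun x => η.mulVec (deriv ξ x)

/-- `P` is Hamiltonian on the fields with values in `U`: the bracket
`{I_ξ, I_ζ}[u] = ∫ ξ_i (P_u ζ)^i dx` of the functionals `I_ξ[u] = ∫ ξ_i u^i dx` is skew-symmetric
and satisfies the Jacobi identity. Here `{{I_1, I_2}, I_3}` is the derivative of `{I_1, I_2}`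
along the Hamiltonian vector field `P_u ξ_3` of `I_3`. -/
def IsHamiltonian {N : ℕ} (U : Set (Coord N))
    (P : (ℝ → Coord N) → (ℝ → Coord N) → (ℝ → Coord N)) : Prop :=
  ∀ u, IsField U u →
    (∀ ξ ζ, IsTest ξ → IsTest ζ → pairing ξ (P u ζ) = -pairing ζ (P u ξ)) ∧
    ∀ ξ₁ ξ₂ ξ₃, IsTest ξ₁ → IsTest ξ₂ → IsTest ξ₃ →
      ∃ a b c : ℝ,
        HasDerivAt (fun ε : ℝ => pairing ξ₁ (P (u + ε • P u ξ₃) ξ₂)) a 0 ∧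
        HasDerivAt (fun ε : ℝ => pairing ξ₂ (P (u + ε • P u ξ₁) ξ₃)) b 0 ∧
        HasDerivAt (fun ε : ℝ => pairing ξ₃ (P (u + ε • P u ξ₂) ξ₁)) c 0 ∧
        a + b + c = 0

end HydroHierarchy

end

/-! On each convex open set two closedness conditions drive the hierarchy. If the Hessian of `h`
commutes with those of the `ψ_n` in the sense `A η B = B η A`, then the first relation of the
recursion defines a closed form, so `F` exists. If `F` solves the first relation, the Gauss
equations make the second relation a system for the Hessian of a function, whose solution `h'` has
Hessian `μ^{mn} F_n ∂∂ψ_m`, a combination of the Hessians of the `ψ_m`; hence these again commute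
with the Hessian of `h'`, and the recursion goes on. In these terms `M₂ δH` is `η (∂∂h) u_x`, and
`M₁ δH` takes the values `η (μ^{mn} F_n ∂∂ψ_m) u_x = η (∂∂h') u_x`, so `R` replaces `h` by `h'`.
Commuting Hessians give commuting flows and involution for `M₂`; the Gauss equations give
involution for `M₁`.

For test covectors, `M₁ ξ` is `η A_ξ u_x` with `A_ξ` a combination of Hessians with nonlocal
coefficients. By the Gauss equations, the derivative of the bracket of `I_ξ` and `I_ζ` along `v` is,
up to an integration by parts, the integral of `ζ_x η A_ξ v - ξ_x η A_ζ v`, and with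
`v = η (a A_θ u_x + b θ_x)` the cyclic sum vanishes pointwise because the matrices `A_ξ` are
symmetric and commute through `η`. -/

namespace HydroHierarchy

open Matrix MeasureTheory Set Filter Topology

/-! ### Calculus of vector-valued functions -/

section Calculus

variable {ι κ E F G : Type*} [Fintype κ]
  [NormedAddCommGroup E] [NormedSpace ℝ E] [NormedAddCommGroup F] [NormedSpace ℝ F]
  [NormedAddCommGroup G] [NormedSpace ℝ G]

theorem hasDerivAt_dotProduct {f g : ℝ → κ → ℝ} {f' g' : κ → ℝ} {x : ℝ}
    (hf : HasDerivAt f f' x) (hg : HasDerivAt g g' x) :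
    HasDerivAt (fun y => f y ⬝ᵥ g y) (f' ⬝ᵥ g x + f x ⬝ᵥ g') x := by
  simp only [dotProduct, ← Finset.sum_add_distrib]
  exact HasDerivAt.fun_sum fun i _ => (hasDerivAt_pi.1 hf i).mul (hasDerivAt_pi.1 hg i)

theorem hasDerivAt_mulVec [Finite ι] (M : Matrix ι κ ℝ) {f : ℝ → κ → ℝ} {f' : κ → ℝ} {x : ℝ}
    (hf : HasDerivAt f f' x) : HasDerivAt (fun y => M *ᵥ f y) (M *ᵥ f') x := by
  cases nonempty_fintype ι
  exact (M.mulVecLin.toContinuousLinearMap.hasFDerivAt).comp_hasDerivAt x hf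

theorem fderiv_mulVec_apply [Finite ι] (M : Matrix ι κ ℝ) {f : E → κ → ℝ} {u : E}
    (hf : DifferentiableAt ℝ f u) (v : E) :
    fderiv ℝ (fun w => M *ᵥ f w) u v = M *ᵥ fderiv ℝ f u v := by
  cases nonempty_fintype ι
  have h : HasFDerivAt (fun w => M *ᵥ f w) _ u :=
    M.mulVecLin.toContinuousLinearMap.hasFDerivAt.comp u hf.hasFDerivAt
  rw [h.fderiv]
  rfl

theorem fderiv_dotProduct_apply {f g : E → κ → ℝ} {u : E} (hf : DifferentiableAt ℝ f u)
    (hg : DifferentiableAt ℝ g u) (v : E) :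
    fderiv ℝ (fun w => f w ⬝ᵥ g w) u v = fderiv ℝ f u v ⬝ᵥ g u + f u ⬝ᵥ fderiv ℝ g u v := by
  have h : HasFDerivAt (fun w => f w ⬝ᵥ g w) _ u := HasFDerivAt.fun_sum fun i _ =>
    (hasFDerivAt_pi'.1 hf.hasFDerivAt i).mul (hasFDerivAt_pi'.1 hg.hasFDerivAt i)
  rw [h.fderiv]
  simp [dotProduct, Finset.sum_add_distrib, mul_comm, add_comm]

theorem contDiffOn_mulVec [Fintype ι] {f : E → κ → ℝ} {s : Set E} (M : Matrix ι κ ℝ)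
    (hf : ContDiffOn ℝ ∞ f s) : ContDiffOn ℝ ∞ (fun u => M *ᵥ f u) s :=
  M.mulVecLin.toContinuousLinearMap.contDiff.comp_contDiffOn hf

theorem contDiffOn_dotProduct {f g : E → κ → ℝ} {s : Set E}
    (hf : ContDiffOn ℝ ∞ f s) (hg : ContDiffOn ℝ ∞ g s) :
    ContDiffOn ℝ ∞ (fun u => f u ⬝ᵥ g u) s :=
  ContDiffOn.sum fun i _ => (contDiffOn_pi.1 hf i).mul (contDiffOn_pi.1 hg i)

theorem differentiableAt_of_contDiffOn {V : Set E} (hV : IsOpen V) {f : E → F}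
    (hf : ContDiffOn ℝ ∞ f V) {u : E} (hu : u ∈ V) : DifferentiableAt ℝ f u :=
  (hf.contDiffAt (hV.mem_nhds hu)).differentiableAt (by simp)

theorem isSymmSndFDerivAt_of_contDiffOn {V : Set E} (hV : IsOpen V) {f : E → F}
    (hf : ContDiffOn ℝ ∞ f V) {u : E} (hu : u ∈ V) : IsSymmSndFDerivAt ℝ f u :=
  (hf.contDiffAt (hV.mem_nhds hu)).isSymmSndFDerivAt <| by
    rw [minSmoothness_of_isRCLikeNormedField]
    exact ENat.LEInfty.out

theorem differentiableAt_fderiv_of_contDiffOn {V : Set E} (hV : IsOpen V) {f : E → F}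
    (hf : ContDiffOn ℝ ∞ f V) {u : E} (hu : u ∈ V) : DifferentiableAt ℝ (fderiv ℝ f) u :=
  differentiableAt_of_contDiffOn hV (hf.fderiv_of_isOpen hV (m := ∞) (by simp)) hu

/-- The form `B(f, dg)` is closed when `B(df ∧ dg) = 0`, because `B(f, d(dg))` is symmetric. -/
theorem exists_fderiv_eq_bilinear {V : Set E} (hV : IsOpen V) (hc : Convex ℝ V)
    (B : F →L[ℝ] G →L[ℝ] ℝ) {f : E → F} {g : E → G}
    (hf : ContDiffOn ℝ ∞ f V) (hg : ContDiffOn ℝ ∞ g V)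
    (hsymm : ∀ u ∈ V, ∀ x y,
      B (fderiv ℝ f u x) (fderiv ℝ g u y) = B (fderiv ℝ f u y) (fderiv ℝ g u x)) :
    ∃ Q : E → ℝ, ContDiffOn ℝ ∞ Q V ∧
      ∀ u ∈ V, ∀ y, fderiv ℝ Q u y = B (f u) (fderiv ℝ g u y) := by
  set θ : E → E →L[ℝ] ℝ := fun u => (B (f u)).comp (fderiv ℝ g u)
  have hθ : ContDiffOn ℝ ∞ θ V :=
    (B.contDiff.comp_contDiffOn hf).clm_comp (hg.fderiv_of_isOpen hV (by simp))
  have fderiv_θ : ∀ u ∈ V, ∀ x y, fderiv ℝ θ u x y =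
      B (f u) (fderiv ℝ (fderiv ℝ g) u x y) + B (fderiv ℝ f u x) (fderiv ℝ g u y) := by
    intro u hu x y
    have hBf := B.hasFDerivAt.comp u (differentiableAt_of_contDiffOn hV hf hu).hasFDerivAt
    have hdg := (differentiableAt_fderiv_of_contDiffOn hV hg hu).hasFDerivAt
    have hθ' : HasFDerivAt θ _ u := hBf.clm_comp hdg
    simp [hθ'.fderiv]
  obtain ⟨Q, hQ⟩ := hc.exists_forall_hasFDerivAt_of_fderiv_symmetric hV
    (hθ.differentiableOn (by simp)) fun u hu x y => by
      rw [fderiv_θ u hu, fderiv_θ u hu, isSymmSndFDerivAt_of_contDiffOn hV hg hu x y,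
        hsymm u hu x y]
  refine ⟨Q, ?_, fun u hu y => by rw [(hQ u hu).fderiv]; rfl⟩
  rw [contDiffOn_infty_iff_fderiv_of_isOpen hV]
  exact ⟨fun u hu => (hQ u hu).differentiableAt.differentiableWithinAt,
    hθ.congr fun u hu => (hQ u hu).fderiv⟩

theorem exists_fderiv_eq_dotProduct_mulVec [Fintype ι] {V : Set E} (hV : IsOpen V) (hc : Convex ℝ V)
    (M : Matrix ι κ ℝ) {f : E → ι → ℝ} {g : E → κ → ℝ}
    (hf : ContDiffOn ℝ ∞ f V) (hg : ContDiffOn ℝ ∞ g V)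
    (hsymm : ∀ u ∈ V, ∀ x y,
      fderiv ℝ f u x ⬝ᵥ M *ᵥ fderiv ℝ g u y = fderiv ℝ f u y ⬝ᵥ M *ᵥ fderiv ℝ g u x) :
    ∃ Q : E → ℝ, ContDiffOn ℝ ∞ Q V ∧
      ∀ u ∈ V, ∀ y, fderiv ℝ Q u y = f u ⬝ᵥ M *ᵥ fderiv ℝ g u y := by
  classical
  let B₀ : (ι → ℝ) →ₗ[ℝ] (κ → ℝ) →ₗ[ℝ] ℝ := Matrix.toLinearMap₂' ℝ M
  let B := B₀.toContinuousBilinearMap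
  have B_apply : ∀ a b, B a b = a ⬝ᵥ M *ᵥ b := Matrix.toLinearMap₂'_apply' M
  simpa only [B_apply] using
    exists_fderiv_eq_bilinear hV hc B hf hg (by simpa only [B_apply] using hsymm)

/-- The linearization of `u ↦ ∂ₓ(f(u)) = f'(u) u_x` along `v` is `∂ₓ(f'(u) v)`, by the symmetry of
the second derivative. -/
theorem hasDerivAt_fderiv_comp_add_smul {V : Set E} (hV : IsOpen V) {f : E → F}
    (hf : ContDiffOn ℝ ∞ f V) {u v : ℝ → E} {x : ℝ} (hu : DifferentiableAt ℝ u x)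
    (hv : DifferentiableAt ℝ v x) (hux : u x ∈ V) :
    HasDerivAt (fun ε : ℝ => fderiv ℝ f ((u + ε • v) x) (deriv (u + ε • v) x))
      (deriv (fun y => fderiv ℝ f (u y) (v y)) x) 0 := by
  have hD := (differentiableAt_fderiv_of_contDiffOn hV hf hux).hasFDerivAt
  have line : ∀ a b : E, HasDerivAt (fun ε : ℝ => a + ε • b) b 0 := fun a b => by
    simpa using ((hasDerivAt_id (0 : ℝ)).smul_const b).const_add a
  have along_x : HasDerivAt (fun y => fderiv ℝ f (u y) (v y)) _ x :=
    (hD.comp_hasDerivAt x hu.hasDerivAt).clm_apply hv.hasDerivAt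
  have along_v := (hD.comp_hasDerivAt_of_eq (0 : ℝ)
    (line (u x) (v x)) (by simp)).clm_apply (line (deriv u x) (deriv v x))
  have deriv_line : ∀ ε : ℝ, deriv (u + ε • v) x = deriv u x + ε • deriv v x := fun ε => by
    rw [deriv_add hu (hv.const_smul ε), deriv_const_smul ε hv]
  simp only [deriv_line]
  refine along_v.congr_deriv ?_
  rw [along_x.deriv, isSymmSndFDerivAt_of_contDiffOn hV hf hux (v x)]
  simp

end Calculus

/-! ### Gradients and Hessians -/

section Gradient

variable {N : ℕ} {V : Set (Coord N)} {f g : Coord N → ℝ} {u : Coord N}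

/-- The gradient `(∂_i f)`, as a vector. -/
noncomputable def grad (f : Coord N → ℝ) (u : Coord N) : Coord N := fun i => pd i f u

/-- The Hessian matrix `(∂_i ∂_j f)`. -/
noncomputable def hess (f : Coord N → ℝ) (u : Coord N) : Matrix (Fin N) (Fin N) ℝ :=
  Matrix.of fun i j => pd2 i j f u

/-- The Hessians of `f` and `g`, with an index raised by `η`, commute on `V`. -/
def HessCommute (V : Set (Coord N)) (η : Matrix (Fin N) (Fin N) ℝ) (f g : Coord N → ℝ) : Prop :=
  ∀ u ∈ V, hess f u * η * hess g u = hess g u * η * hess f u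

theorem fderiv_apply_eq_grad_dotProduct (f : Coord N → ℝ) (u v : Coord N) :
    fderiv ℝ f u v = grad f u ⬝ᵥ v := by
  conv_lhs => rw [pi_eq_sum_univ' v, map_sum]
  simp only [map_smul, smul_eq_mul, dotProduct, grad, pd, mul_comm]

theorem contDiffOn_grad (hV : IsOpen V) (hf : ContDiffOn ℝ ∞ f V) : ContDiffOn ℝ ∞ (grad f) V :=
  contDiffOn_pi.2 fun _ =>
    (hf.fderiv_of_isOpen hV (m := ∞) (by simp)).clm_apply contDiffOn_const

theorem hess_apply_eq_fderiv_fderiv (hV : IsOpen V) (hf : ContDiffOn ℝ ∞ f V) (hu : u ∈ V)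
    (i j : Fin N) :
    hess f u i j = fderiv ℝ (fderiv ℝ f) u (Pi.single i 1) (Pi.single j 1) := by
  change fderiv ℝ (fun v => fderiv ℝ f v (Pi.single j 1)) u (Pi.single i 1) = _
  rw [fderiv_clm_apply (differentiableAt_fderiv_of_contDiffOn hV hf hu) (by fun_prop)]
  simp

theorem hess_isSymm (hV : IsOpen V) (hf : ContDiffOn ℝ ∞ f V) (hu : u ∈ V) :
    (hess f u).IsSymm := by
  ext i j
  rw [transpose_apply, hess_apply_eq_fderiv_fderiv hV hf hu, hess_apply_eq_fderiv_fderiv hV hf hu]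
  exact isSymmSndFDerivAt_of_contDiffOn hV hf hu _ _

theorem fderiv_grad_apply (hV : IsOpen V) (hf : ContDiffOn ℝ ∞ f V) (hu : u ∈ V) (v : Coord N) :
    fderiv ℝ (grad f) u v = hess f u *ᵥ v := by
  have hgrad := differentiableAt_of_contDiffOn hV (contDiffOn_grad hV hf) hu
  ext i
  rw [fderiv_pi fun i => differentiableAt_pi.1 hgrad i, ContinuousLinearMap.pi_apply,
    fderiv_apply_eq_grad_dotProduct]
  exact congrArg (· ⬝ᵥ v) (funext fun j => (hess_isSymm hV hf hu).apply i j)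

theorem contDiffOn_hess (hV : IsOpen V) (hf : ContDiffOn ℝ ∞ f V) (i j : Fin N) :
    ContDiffOn ℝ ∞ (fun u => hess f u i j) V :=
  contDiffOn_pi.1 (contDiffOn_grad hV (contDiffOn_pi.1 (contDiffOn_grad hV hf) j)) i

theorem grad_eqOn (hV : IsOpen V) (h : EqOn f g V) : EqOn (grad f) (grad g) V := fun u hu => by
  have hfg : f =ᶠ[𝓝 u] g := h.eventuallyEq_of_mem (hV.mem_nhds hu)
  ext i
  rw [grad, grad, pd, pd, hfg.fderiv_eq]

theorem hess_eqOn (hV : IsOpen V) (h : EqOn f g V) : EqOn (hess f) (hess g) V := fun u hu => by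
  ext i j
  exact congrFun (grad_eqOn hV (fun v hv => congrFun (grad_eqOn hV h hv) j) hu) i

theorem hess_mulVec_eq_fderiv_of_grad_eqOn (hV : IsOpen V) (hf : ContDiffOn ℝ ∞ f V)
    {θ : Coord N → Coord N} (hθ : EqOn (grad f) θ V) (hu : u ∈ V) (v : Coord N) :
    hess f u *ᵥ v = fderiv ℝ θ u v := by
  rw [← fderiv_grad_apply hV hf hu, (hθ.eventuallyEq_of_mem (hV.mem_nhds hu)).fderiv_eq]

theorem exists_grad_eq (hV : IsOpen V) (hc : Convex ℝ V) {θ : Coord N → Coord N}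
    (hθ : ContDiffOn ℝ ∞ θ V)
    (hsymm : ∀ u ∈ V, ∀ x y, fderiv ℝ θ u x ⬝ᵥ y = fderiv ℝ θ u y ⬝ᵥ x) :
    ∃ Q : Coord N → ℝ, ContDiffOn ℝ ∞ Q V ∧ EqOn (grad Q) θ V := by
  obtain ⟨Q, hQ, hdQ⟩ := exists_fderiv_eq_dotProduct_mulVec hV hc (1 : Matrix (Fin N) (Fin N) ℝ)
    hθ contDiffOn_id (by simpa using hsymm)
  refine ⟨Q, hQ, fun u hu => funext fun i => ?_⟩
  rw [grad, pd, hdQ u hu, one_mulVec, fderiv_id, ContinuousLinearMap.id_apply,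
    dotProduct_single_one]

end Gradient

/-! ### The Gauss equations and commuting Hessians -/

section SecondFundamentalForm

variable {N L : ℕ} {V : Set (Coord N)} {η : Matrix (Fin N) (Fin N) ℝ}
  {μ : Matrix (Fin L) (Fin L) ℝ} {ψ : Fin L → Coord N → ℝ} {u : Coord N}

theorem dotProduct_mulVec_comm {ι : Type*} [Fintype ι] {A : Matrix ι ι ℝ} (hA : A.IsSymm)
    (a b : ι → ℝ) : a ⬝ᵥ A *ᵥ b = b ⬝ᵥ A *ᵥ a := by
  rw [← dotProduct_transpose_mulVec, hA.eq]

theorem mulVec_dotProduct {ι : Type*} [Fintype ι] {A : Matrix ι ι ℝ} (hA : A.IsSymm)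
    (a b : ι → ℝ) : A *ᵥ a ⬝ᵥ b = a ⬝ᵥ A *ᵥ b := by
  rw [dotProduct_comm, dotProduct_mulVec_comm hA]

/-- The second fundamental form with components `∂_i ∂_j ψ_n`, evaluated on two tangent vectors. -/
noncomputable def hessForm (ψ : Fin L → Coord N → ℝ) (u a b : Coord N) : Fin L → ℝ :=
  fun n => a ⬝ᵥ hess (ψ n) u *ᵥ b

/-- The Hessian of `∑ c_n ψ_n` for constant `c`: the shape operator in the direction `c`. -/
noncomputable def hessComb (ψ : Fin L → Coord N → ℝ) (u : Coord N) (c : Fin L → ℝ) :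
    Matrix (Fin N) (Fin N) ℝ :=
  ∑ n, c n • hess (ψ n) u

theorem hessForm_comm (hV : IsOpen V) (hψ : ∀ n, ContDiffOn ℝ ∞ (ψ n) V) (hu : u ∈ V)
    (a b : Coord N) : hessForm ψ u a b = hessForm ψ u b a :=
  funext fun n => dotProduct_mulVec_comm (hess_isSymm hV (hψ n) hu) a b

theorem hessComb_isSymm (hV : IsOpen V) (hψ : ∀ n, ContDiffOn ℝ ∞ (ψ n) V) (hu : u ∈ V)
    (c : Fin L → ℝ) : (hessComb ψ u c).IsSymm := by
  simp only [IsSymm, hessComb, transpose_sum, transpose_smul, (hess_isSymm hV (hψ _) hu).eq]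

theorem dotProduct_hessComb_mulVec (ψ : Fin L → Coord N → ℝ) (u : Coord N) (c : Fin L → ℝ)
    (a b : Coord N) : a ⬝ᵥ hessComb ψ u c *ᵥ b = c ⬝ᵥ hessForm ψ u a b := by
  simp only [hessComb, sum_mulVec, dotProduct_sum, smul_mulVec, dotProduct_smul]
  rfl

theorem hessForm_eq_sum (ψ : Fin L → Coord N → ℝ) (u a b : Coord N) :
    hessForm ψ u a b = ∑ i, ∑ j, (a i * b j) • fun n => hess (ψ n) u i j := by
  ext n
  simp only [hessForm, dotProduct, mulVec, Finset.mul_sum, Finset.sum_apply, Pi.smul_apply,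
    smul_eq_mul]
  exact Finset.sum_congr rfl fun i _ => Finset.sum_congr rfl fun j _ => by ring

theorem GaussEquations.hessForm_swap (h : GaussEquations V μ ψ) (hu : u ∈ V)
    (a b c d : Coord N) :
    hessForm ψ u a b ⬝ᵥ μ *ᵥ hessForm ψ u c d = hessForm ψ u a c ⬝ᵥ μ *ᵥ hessForm ψ u b d := by
  have gauss : ∀ i j k l, (fun n => hess (ψ n) u i j) ⬝ᵥ μ *ᵥ (fun n => hess (ψ n) u k l) =
      (fun n => hess (ψ n) u i k) ⬝ᵥ μ *ᵥ (fun n => hess (ψ n) u j l) := by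
    intro i j k l
    have := h u hu i j k l
    simpa only [dotProduct, mulVec, Finset.mul_sum, hess, of_apply, mul_assoc, mul_left_comm]
      using this
  simp only [hessForm_eq_sum, mulVec_sum, mulVec_smul, sum_dotProduct, smul_dotProduct,
    dotProduct_sum, dotProduct_smul, smul_eq_mul, Finset.mul_sum]
  rw [Finset.sum_comm]
  conv_rhs => rw [Finset.sum_comm]
  refine Finset.sum_congr rfl fun l _ => ?_
  rw [Finset.sum_comm]
  conv_rhs => rw [Finset.sum_comm]
  refine Finset.sum_congr rfl fun i _ => ?_
  rw [Finset.sum_comm]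
  refine Finset.sum_congr rfl fun j _ => Finset.sum_congr rfl fun k _ => ?_
  rw [gauss]
  ring

theorem CommutingHessians.hessCommute (h : CommutingHessians V η ψ) (j k : Fin L) :
    HessCommute V η (ψ j) (ψ k) := by
  intro u hu
  have entry : ∀ (j k : Fin L) (i l : Fin N), (hess (ψ j) u * η * hess (ψ k) u) i l =
      ∑ m, ∑ n, η m n * pd2 i m (ψ j) u * pd2 n l (ψ k) u := by
    intro j k i l
    simp only [Matrix.mul_apply, Finset.sum_mul, hess, of_apply]
    rw [Finset.sum_comm]
    exact Finset.sum_congr rfl fun m _ => Finset.sum_congr rfl fun n _ => by ring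
  ext i l
  rw [entry, entry, h u hu]

theorem CommutingHessians.hessComb_mul_comm (h : CommutingHessians V η ψ) (hu : u ∈ V)
    (b c : Fin L → ℝ) :
    hessComb ψ u b * η * hessComb ψ u c = hessComb ψ u c * η * hessComb ψ u b := by
  simp only [hessComb, Finset.sum_mul, Finset.mul_sum, smul_mul_assoc, mul_smul_comm,
    Finset.smul_sum]
  rw [Finset.sum_comm]
  refine Finset.sum_congr rfl fun j _ => Finset.sum_congr rfl fun k _ => ?_
  rw [smul_comm, h.hessCommute j k u hu]

end SecondFundamentalForm

/-! ### The recursion for the conserved densities -/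

section Recursion

variable {N L : ℕ} {V : Set (Coord N)} {η : Matrix (Fin N) (Fin N) ℝ}
  {μ : Matrix (Fin L) (Fin L) ℝ} {ψ : Fin L → Coord N → ℝ} {f g h h' : Coord N → ℝ}
  {F G : Fin L → Coord N → ℝ} {u : Coord N}

theorem HessCommute.isSymm (hfg : HessCommute V η f g) (hη : η.IsSymm) (hV : IsOpen V)
    (hf : ContDiffOn ℝ ∞ f V) (hg : ContDiffOn ℝ ∞ g V) (hu : u ∈ V) :
    (hess f u * η * hess g u).IsSymm := by
  rw [IsSymm, transpose_mul, transpose_mul, (hess_isSymm hV hf hu).eq, (hess_isSymm hV hg hu).eq,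
    hη.eq, ← Matrix.mul_assoc, hfg u hu]

theorem HessCommute.exists_potential (hfg : HessCommute V η f g) (hη : η.IsSymm) (hV : IsOpen V)
    (hc : Convex ℝ V) (hf : ContDiffOn ℝ ∞ f V) (hg : ContDiffOn ℝ ∞ g V) :
    ∃ Q : Coord N → ℝ, ContDiffOn ℝ ∞ Q V ∧
      ∀ u ∈ V, ∀ v, fderiv ℝ Q u v = grad f u ⬝ᵥ η *ᵥ hess g u *ᵥ v := by
  have pairing_eq : ∀ u ∈ V, ∀ x y,
      fderiv ℝ (grad f) u x ⬝ᵥ η *ᵥ fderiv ℝ (grad g) u y =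
        x ⬝ᵥ (hess f u * η * hess g u) *ᵥ y := fun u hu x y => by
    rw [fderiv_grad_apply hV hf hu, fderiv_grad_apply hV hg hu,
      mulVec_dotProduct (hess_isSymm hV hf hu), mulVec_mulVec, mulVec_mulVec]
  obtain ⟨Q, hQ, hdQ⟩ := exists_fderiv_eq_dotProduct_mulVec hV hc η (contDiffOn_grad hV hf)
    (contDiffOn_grad hV hg) fun u hu x y => by
      rw [pairing_eq u hu, pairing_eq u hu, dotProduct_mulVec_comm (hfg.isSymm hη hV hf hg hu)]
  exact ⟨Q, hQ, fun u hu v => by rw [hdQ u hu, fderiv_grad_apply hV hg hu]⟩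

theorem solvesF_iff_grad_eq :
    SolvesF V η ψ h F ↔ (∀ n, ContDiffOn ℝ ∞ (F n) V) ∧
      ∀ u ∈ V, ∀ n, grad (F n) u = (η *ᵥ grad h u) ᵥ* hess (ψ n) u := by
  refine and_congr_right fun _ => forall₂_congr fun u _ => forall_congr' fun n => ?_
  have expand : ∀ p, ((η *ᵥ grad h u) ᵥ* hess (ψ n) u) p =
      ∑ j, ∑ r, pd2 j p (ψ n) u * η j r * pd r h u := fun p => by
    simp only [vecMul, dotProduct, mulVec, grad, hess, of_apply, Finset.sum_mul]
    exact Finset.sum_congr rfl fun j _ => Finset.sum_congr rfl fun r _ => by ring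
  simp only [funext_iff, expand, grad, eq_comm]

theorem SolvesF.fderiv_eq (hF : SolvesF V η ψ h F) (hV : IsOpen V) (hu : u ∈ V) (v : Coord N) :
    fderiv ℝ (fun w n => F n w) u v = hessForm ψ u (η *ᵥ grad h u) v := by
  obtain ⟨hsmooth, hgrad⟩ := solvesF_iff_grad_eq.1 hF
  ext n
  rw [fderiv_pi fun n => differentiableAt_of_contDiffOn hV (hsmooth n) hu,
    ContinuousLinearMap.pi_apply, fderiv_apply_eq_grad_dotProduct, hgrad u hu, hessForm,
    dotProduct_mulVec]

theorem solvesH_iff_hess_eq :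
    SolvesH V μ ψ F h' ↔ ContDiffOn ℝ ∞ h' V ∧
      ∀ u ∈ V, hess h' u = hessComb ψ u (μ *ᵥ fun n => F n u) := by
  refine and_congr_right fun _ => forall₂_congr fun u _ => ?_
  have expand : ∀ j k, hessComb ψ u (μ *ᵥ fun n => F n u) j k =
      ∑ m, ∑ n, μ m n * pd2 j k (ψ m) u * F n u := fun j k => by
    simp only [hessComb, Matrix.sum_apply, Matrix.smul_apply, smul_eq_mul, mulVec, dotProduct,
      hess, of_apply, Finset.sum_mul]
    exact Finset.sum_congr rfl fun m _ => Finset.sum_congr rfl fun n _ => by ring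
  simp only [← Matrix.ext_iff, expand, hess, of_apply, eq_comm]

theorem SolvesH.hess_eq (hh : SolvesH V μ ψ F h') (hu : u ∈ V) :
    hess h' u = hessComb ψ u (μ *ᵥ fun n => F n u) :=
  (solvesH_iff_hess_eq.1 hh).2 u hu

/-- Densities whose Hessian commutes with those of the potentials: those from which a step of the
recursion can be made. -/
def Admissible (V : Set (Coord N)) (η : Matrix (Fin N) (Fin N) ℝ) (ψ : Fin L → Coord N → ℝ)
    (h : Coord N → ℝ) : Prop :=
  ContDiffOn ℝ ∞ h V ∧ ∀ n, HessCommute V η h (ψ n)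

theorem Admissible.exists_solvesF (hh : Admissible V η ψ h) (hη : η.IsSymm) (hV : IsOpen V)
    (hc : Convex ℝ V) (hψ : ∀ n, ContDiffOn ℝ ∞ (ψ n) V) : ∃ F, SolvesF V η ψ h F := by
  choose F hF hdF using fun n => (hh.2 n).exists_potential hη hV hc hh.1 (hψ n)
  refine ⟨F, solvesF_iff_grad_eq.2 ⟨hF, fun u hu n => dotProduct_eq _ _ fun v => ?_⟩⟩
  rw [← fderiv_apply_eq_grad_dotProduct, hdF n u hu, ← dotProduct_mulVec, mulVec_dotProduct hη]

theorem SolvesF.exists_solvesH (hF : SolvesF V η ψ h F) (hμ : μ.IsSymm) (hV : IsOpen V)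
    (hc : Convex ℝ V) (hψ : ∀ n, ContDiffOn ℝ ∞ (ψ n) V) (hgauss : GaussEquations V μ ψ) :
    ∃ h', SolvesH V μ ψ F h' := by
  have hFsmooth : ContDiffOn ℝ ∞ (fun w n => F n w) V := contDiffOn_pi.2 hF.1
  have hgradψ : ∀ k, ContDiffOn ℝ ∞ (fun w n => grad (ψ n) w k) V := fun k =>
    contDiffOn_pi.2 fun n => contDiffOn_pi.1 (contDiffOn_grad hV (hψ n)) k
  have fderiv_gradψ : ∀ k, ∀ u ∈ V, ∀ v,
      fderiv ℝ (fun w n => grad (ψ n) w k) u v = hessForm ψ u (Pi.single k 1) v := by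
    intro k u hu v
    have hgrad := fun n => differentiableAt_of_contDiffOn hV (contDiffOn_grad hV (hψ n)) hu
    ext n
    rw [fderiv_pi fun n => differentiableAt_pi.1 (hgrad n) k, hessForm, single_one_dotProduct,
      ← fderiv_grad_apply hV (hψ n) hu, fderiv_pi fun k => differentiableAt_pi.1 (hgrad n) k]
    rfl
  choose θ hθ hdθ using fun k => exists_fderiv_eq_dotProduct_mulVec hV hc μ hFsmooth (hgradψ k)
    fun u hu x y => by
      rw [hF.fderiv_eq hV hu, hF.fderiv_eq hV hu, fderiv_gradψ k u hu, fderiv_gradψ k u hu,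
        hgauss.hessForm_swap hu, hgauss.hessForm_swap hu _ y, hessForm_comm hV hψ hu x y]
  have fderiv_θ : ∀ u ∈ V, ∀ v, fderiv ℝ (fun w k => θ k w) u v =
      hessComb ψ u (μ *ᵥ fun n => F n u) *ᵥ v := by
    intro u hu v
    ext k
    rw [fderiv_pi fun k => differentiableAt_of_contDiffOn hV (hθ k) hu,
      ContinuousLinearMap.pi_apply, hdθ k u hu, fderiv_gradψ k u hu, ← mulVec_dotProduct hμ,
      ← dotProduct_hessComb_mulVec, single_one_dotProduct]
  obtain ⟨h', hh', hgrad⟩ := exists_grad_eq hV hc (contDiffOn_pi.2 hθ) fun u hu x y => by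
    rw [fderiv_θ u hu, fderiv_θ u hu, mulVec_dotProduct (hessComb_isSymm hV hψ hu _),
      dotProduct_comm]
  refine ⟨h', solvesH_iff_hess_eq.2 ⟨hh', fun u hu => ext_iff_mulVec.2 fun v => ?_⟩⟩
  rw [hess_mulVec_eq_fderiv_of_grad_eqOn hV hh' hgrad hu, fderiv_θ u hu]

theorem SolvesH.hessCommute (hh : SolvesH V μ ψ F h') (hg : ∀ n, HessCommute V η g (ψ n)) :
    HessCommute V η g h' := fun u hu => by
  simp only [hh.hess_eq hu, hessComb, Finset.mul_sum, Finset.sum_mul, mul_smul_comm,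
    smul_mul_assoc, hg _ u hu]

theorem SolvesH.admissible (hh : SolvesH V μ ψ F h') (hcomm : CommutingHessians V η ψ) :
    Admissible V η ψ h' :=
  ⟨hh.1, fun n u hu => (hh.hessCommute (hcomm.hessCommute n) u hu).symm⟩

/-- The density `½ a_{ij} u^i u^j`; the recursion starts from `a = η⁻¹`. -/
noncomputable def quadDensity (A : Matrix (Fin N) (Fin N) ℝ) (u : Coord N) : ℝ :=
  (1 / 2) * (u ⬝ᵥ A *ᵥ u)

theorem quadDensity_eq_sum (A : Matrix (Fin N) (Fin N) ℝ) (u : Coord N) :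
    quadDensity A u = (1 / 2) * ∑ i, ∑ j, A i j * u i * u j := by
  simp only [quadDensity, dotProduct, mulVec, Finset.mul_sum]
  exact Finset.sum_congr rfl fun i _ => Finset.sum_congr rfl fun j _ => by ring

theorem contDiff_quadDensity (A : Matrix (Fin N) (Fin N) ℝ) : ContDiff ℝ ∞ (quadDensity A) :=
  contDiff_const.mul <| contDiffOn_univ.1 <|
    contDiffOn_dotProduct contDiffOn_id (contDiffOn_mulVec A contDiffOn_id)

theorem grad_quadDensity {A : Matrix (Fin N) (Fin N) ℝ} (hA : A.IsSymm) (u : Coord N) :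
    grad (quadDensity A) u = A *ᵥ u := by
  have hA' : ContDiff ℝ ∞ fun w => A *ᵥ w :=
    contDiffOn_univ.1 (contDiffOn_mulVec A contDiffOn_id)
  have hd : DifferentiableAt ℝ (fun w : Coord N => w ⬝ᵥ A *ᵥ w) u :=
    (contDiffOn_univ.1 (contDiffOn_dotProduct contDiffOn_id hA'.contDiffOn)).contDiffAt
      |>.differentiableAt (by simp)
  refine dotProduct_eq _ _ fun v => ?_
  rw [← fderiv_apply_eq_grad_dotProduct]
  have hquad : fderiv ℝ (quadDensity A) u v =
      1 / 2 * fderiv ℝ (fun w : Coord N => w ⬝ᵥ A *ᵥ w) u v := by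
    unfold quadDensity
    rw [fderiv_const_mul hd]
    rfl
  rw [hquad, fderiv_dotProduct_apply differentiableAt_fun_id
    (hA'.differentiable (by simp) u), fderiv_mulVec_apply A differentiableAt_fun_id,
    fderiv_fun_id, ContinuousLinearMap.id_apply, dotProduct_mulVec_comm hA u v,
    mulVec_dotProduct hA, dotProduct_mulVec_comm hA u v]
  ring

theorem hess_quadDensity {A : Matrix (Fin N) (Fin N) ℝ} (hA : A.IsSymm) (u : Coord N) :
    hess (quadDensity A) u = A := by
  refine ext_iff_mulVec.2 fun v => ?_
  rw [hess_mulVec_eq_fderiv_of_grad_eqOn isOpen_univ (contDiff_quadDensity A).contDiffOn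
    (fun w _ => grad_quadDensity hA w) (mem_univ u), fderiv_mulVec_apply A differentiableAt_fun_id]
  simp

theorem exists_hess_eq_grad_eq_add (hV : IsOpen V) (hh : ContDiffOn ℝ ∞ h V) (c : Coord N) :
    ∃ g : Coord N → ℝ, ContDiffOn ℝ ∞ g V ∧
      ∀ u ∈ V, grad g u = grad h u + c ∧ hess g u = hess h u := by
  have hlin : ContDiff ℝ ∞ fun v : Coord N => c ⬝ᵥ v :=
    contDiffOn_univ.1 (contDiffOn_dotProduct contDiffOn_const contDiffOn_id)
  have hg : ContDiffOn ℝ ∞ (fun v => h v + c ⬝ᵥ v) V := hh.add hlin.contDiffOn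
  have hgrad : ∀ u ∈ V, grad (fun v => h v + c ⬝ᵥ v) u = grad h u + c := fun u hu => by
    refine dotProduct_eq _ _ fun v => ?_
    rw [← fderiv_apply_eq_grad_dotProduct, add_dotProduct, ← fderiv_apply_eq_grad_dotProduct,
      fderiv_fun_add (differentiableAt_of_contDiffOn hV hh hu)
        (hlin.differentiable (by simp) u), _root_.add_apply,
      fderiv_dotProduct_apply (differentiableAt_const c) differentiableAt_fun_id]
    simp
  refine ⟨_, hg, fun u hu => ⟨hgrad u hu, ext_iff_mulVec.2 fun v => ?_⟩⟩
  rw [hess_mulVec_eq_fderiv_of_grad_eqOn hV hg hgrad hu, fderiv_add_const,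
    fderiv_grad_apply hV hh hu]

theorem Admissible.exists_grad_eq_add (hh : Admissible V η ψ h) (hV : IsOpen V) (c : Coord N) :
    ∃ g, Admissible V η ψ g ∧ ∀ u ∈ V, grad g u = grad h u + c := by
  obtain ⟨g, hg, heq⟩ := exists_hess_eq_grad_eq_add hV hh.1 c
  exact ⟨g, ⟨hg, fun n u hu => by rw [(heq u hu).2, hh.2 n u hu]⟩, fun u hu => (heq u hu).1⟩

theorem SolvesF.add_const (hF : SolvesF V η ψ h F) (c : Fin L → ℝ) :
    SolvesF V η ψ h fun n v => F n v + c n := by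
  refine ⟨fun n => (hF.1 n).add contDiffOn_const, fun u hu n p => ?_⟩
  rw [hF.2 u hu, pd, pd, fderiv_add_const]

theorem hessCommute_of_hess_eq_inv (hη : η.det ≠ 0) (hf : ∀ u ∈ V, hess f u = η⁻¹)
    (g : Coord N → ℝ) : HessCommute V η f g := fun u hu => by
  have hη : IsUnit η.det := hη.isUnit
  rw [hf u hu, nonsing_inv_mul η hη, Matrix.mul_assoc, mul_nonsing_inv η hη, Matrix.one_mul,
    Matrix.mul_one]

end Recursion

section Solutions

variable {N L K s : ℕ} {V : Set (Coord N)} {η : Matrix (Fin N) (Fin N) ℝ}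
  {μ : Matrix (Fin L) (Fin L) ℝ} {ψ : Fin L → Coord N → ℝ} {g : Coord N → ℝ}
  {F : ℕ → Fin L → Coord N → ℝ} {h : ℕ → Coord N → ℝ}

theorem SolvesUpTo.eqOn_quadDensity (hs : SolvesUpTo V η μ ψ K F h) :
    EqOn (h 1) (quadDensity η⁻¹) V := fun u hu =>
  (hs.1 u hu).trans (quadDensity_eq_sum η⁻¹ u).symm

theorem SolvesUpTo.hess_one_eq (hs : SolvesUpTo V η μ ψ K F h) (hη : η.IsSymm) (hV : IsOpen V)
    {u : Coord N} (hu : u ∈ V) : hess (h 1) u = η⁻¹ := by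
  rw [hess_eqOn hV hs.eqOn_quadDensity hu, hess_quadDensity (IsSymm.inv hη)]

theorem SolvesUpTo.hessCommute (hs : SolvesUpTo V η μ ψ K F h) (hη : η.IsSymm)
    (hη' : η.det ≠ 0) (hV : IsOpen V) (hsK : s ≤ K) (hg : ∀ n, HessCommute V η g (ψ n)) :
    HessCommute V η g (h (s + 1)) := by
  rcases Nat.eq_zero_or_pos s with rfl | h1
  · exact fun u hu => (hessCommute_of_hess_eq_inv hη' (fun u => hs.hess_one_eq hη hV) g u hu).symm
  · exact (hs.2 s h1 hsK).2.hessCommute hg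

theorem SolvesUpTo.admissible (hs : SolvesUpTo V η μ ψ K F h) (hη : η.IsSymm)
    (hη' : η.det ≠ 0) (hV : IsOpen V) (hcomm : CommutingHessians V η ψ) (hsK : s ≤ K) :
    Admissible V η ψ (h (s + 1)) := by
  refine ⟨?_, fun n u hu => (hs.hessCommute hη hη' hV hsK (hcomm.hessCommute n) u hu).symm⟩
  rcases Nat.eq_zero_or_pos s with rfl | h1
  · exact (contDiff_quadDensity _).contDiffOn.congr hs.eqOn_quadDensity
  · exact (hs.2 s h1 hsK).2.1

theorem admissible_quadDensity_inv (hη : η.IsSymm) (hη' : η.det ≠ 0) :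
    Admissible V η ψ (quadDensity η⁻¹) :=
  ⟨(contDiff_quadDensity _).contDiffOn, fun n => hessCommute_of_hess_eq_inv hη'
    (fun u _ => hess_quadDensity (IsSymm.inv hη) u) (ψ n)⟩

theorem exists_solvesRecursion (hη : η.IsSymm) (hη' : η.det ≠ 0) (hμ : μ.IsSymm) (hV : IsOpen V)
    (hc : Convex ℝ V) (hψ : ∀ n, ContDiffOn ℝ ∞ (ψ n) V) (hcomm : CommutingHessians V η ψ)
    (hgauss : GaussEquations V μ ψ) : ∃ F h, SolvesRecursion V η μ ψ F h := by
  have step : ∀ h : {h // Admissible V η ψ h}, ∃ (F : Fin L → Coord N → ℝ)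
      (h' : {h // Admissible V η ψ h}), SolvesF V η ψ h F ∧ SolvesH V μ ψ F h' := by
    rintro ⟨h, hh⟩
    obtain ⟨F, hF⟩ := hh.exists_solvesF hη hV hc hψ
    obtain ⟨h', hh'⟩ := hF.exists_solvesH hμ hV hc hψ hgauss
    exact ⟨F, ⟨h', hh'.admissible hcomm⟩, hF, hh'⟩
  choose nextF nextH hF hH using step
  let density : ℕ → {h // Admissible V η ψ h} :=
    fun s => nextH^[s] ⟨quadDensity η⁻¹, admissible_quadDensity_inv hη hη'⟩
  have solvesH_density : ∀ s, SolvesH V μ ψ (nextF (density s)) (density (s + 1)) := fun s => by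
    simpa only [density, Function.iterate_succ_apply'] using hH (density s)
  refine ⟨fun s => nextF (density (s - 1)), fun s => density (s - 1), fun K => ⟨fun u _ => ?_, ?_⟩⟩
  · exact quadDensity_eq_sum η⁻¹ u
  · rintro (_ | s) h1 -
    · omega
    · exact ⟨hF (density s), solvesH_density s⟩

theorem SolvesRecursion.solvesF (hs : SolvesRecursion V η μ ψ F h) (h1 : 1 ≤ s) :
    SolvesF V η ψ (h s) (F s) :=
  ((hs s).2 s h1 le_rfl).1

theorem SolvesRecursion.solvesH (hs : SolvesRecursion V η μ ψ F h) (h1 : 1 ≤ s) :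
    SolvesH V μ ψ (F s) (h (s + 1)) :=
  ((hs s).2 s h1 le_rfl).2

theorem SolvesRecursion.admissible (hs : SolvesRecursion V η μ ψ F h) (hη : η.IsSymm)
    (hη' : η.det ≠ 0) (hV : IsOpen V) (hcomm : CommutingHessians V η ψ) (h1 : 1 ≤ s) :
    Admissible V η ψ (h s) := by
  obtain ⟨t, rfl⟩ := Nat.exists_eq_add_of_le' h1
  exact (hs t).admissible hη hη' hV hcomm le_rfl

theorem SolvesRecursion.hessCommute (hs : SolvesRecursion V η μ ψ F h) (hη : η.IsSymm)
    (hη' : η.det ≠ 0) (hV : IsOpen V) (hg : Admissible V η ψ g) (h1 : 1 ≤ s) :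
    HessCommute V η g (h s) := by
  obtain ⟨t, rfl⟩ := Nat.exists_eq_add_of_le' h1
  exact (hs t).hessCommute hη hη' hV le_rfl hg.2

end Solutions

/-! ### Local expressions -/

section Local

variable {N : ℕ} {V : Set (Coord N)} {u v : ℝ → Coord N}
  {W : Type} [NormedAddCommGroup W] [NormedSpace ℝ W]

theorem IsField.differentiableAt (hu : IsField V u) (x : ℝ) : DifferentiableAt ℝ u x :=
  hu.1.differentiable (by simp) x

theorem IsField.contDiff_deriv (hu : IsField V u) : ContDiff ℝ ∞ (deriv u) :=
  (contDiff_infty_iff_deriv.1 hu.1).2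

theorem IsField.hasDerivAt_comp (hu : IsField V u) (hV : IsOpen V) {f : Coord N → W}
    (hf : ContDiffOn ℝ ∞ f V) (x : ℝ) :
    HasDerivAt (fun y => f (u y)) (fderiv ℝ f (u x) (deriv u x)) x :=
  (differentiableAt_of_contDiffOn hV hf (hu.2 x)).hasFDerivAt.comp_hasDerivAt x
    (hu.differentiableAt x).hasDerivAt

theorem isLocal_comp {f : Coord N → W} (hf : ContDiffOn ℝ ∞ f V) :
    IsLocal V (fun u x => f (u x)) :=
  ⟨0, fun J => f (J 0), hf.comp (contDiff_apply ℝ (Coord N) 0).contDiffOn fun _ hJ => hJ,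
    fun u _ x => by simp⟩

theorem isInvDx_comp (hV : IsOpen V) {f : Coord N → W} (hf : ContDiffOn ℝ ∞ f V)
    {P : FieldFun N W} (hP : ∀ u, IsField V u → ∀ x, P u x = fderiv ℝ f (u x) (deriv u x)) :
    IsInvDx V P fun u x => f (u x) :=
  ⟨isLocal_comp hf, fun u hu x => hP u hu x ▸ hu.hasDerivAt_comp hV hf x⟩

theorem IsLocal.congr_germ {P : FieldFun N W} (hP : IsLocal V P) (hu : IsField V u)
    (hv : IsField V v) {x : ℝ} (h : u =ᶠ[𝓝 x] v) : P u x = P v x := by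
  obtain ⟨k, f, -, hf⟩ := hP
  rw [hf u hu, hf v hv]
  exact congrArg f (funext fun a => h.iteratedDeriv_eq a)

theorem exists_field_interpolating (hc : Convex ℝ V) (hu : IsField V u) (hv : IsField V v) :
    ∃ w, IsField V w ∧ w =ᶠ[𝓝 0] u ∧ w =ᶠ[𝓝 1] v := by
  let χ : ℝ → ℝ := fun x => Real.smoothTransition (3 * x - 1)
  have hχ : ContDiff ℝ ∞ χ := Real.smoothTransition.contDiff.comp (by fun_prop)
  refine ⟨fun x => (1 - χ x) • u x + χ x • v x, ⟨?_, fun x => ?_⟩, ?_, ?_⟩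
  · exact ((contDiff_const.sub hχ).smul hu.1).add (hχ.smul hv.1)
  · exact hc (hu.2 x) (hv.2 x) (sub_nonneg.2 (Real.smoothTransition.le_one _))
      (Real.smoothTransition.nonneg _) (by ring)
  · filter_upwards [Iio_mem_nhds (show (0 : ℝ) < 1 / 3 by norm_num)] with x (hx : x < 1 / 3)
    have : χ x = 0 := Real.smoothTransition.zero_of_nonpos (by linarith)
    simp [this]
  · filter_upwards [Ioi_mem_nhds (show (2 / 3 : ℝ) < 1 by norm_num)] with x (hx : 2 / 3 < x)
    have : χ x = 1 := Real.smoothTransition.one_of_one_le (by linarith)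
    simp [this]

/-- The constant does not depend on the field: any two fields are joined by a third one, which has
the germ of the first at `0` and the germ of the second at `1`. -/
theorem IsLocal.eq_add_const {P Q R : FieldFun N W} (hP : IsLocal V P) (hQ : IsLocal V Q)
    (hc : Convex ℝ V) (hPR : IsTotalDeriv V P R) (hQR : IsTotalDeriv V Q R) :
    ∃ c, ∀ u, IsField V u → ∀ x, P u x = Q u x + c := by
  have sub_const : ∀ u, IsField V u → ∀ x y, P u x - Q u x = P u y - Q u y := by
    intro u hu
    have hsub : ∀ x, HasDerivAt (fun y => P u y - Q u y) 0 x := fun x => by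
      simpa only [sub_self] using (hPR u hu x).fun_sub (hQR u hu x)
    exact is_const_of_deriv_eq_zero (fun x => (hsub x).differentiableAt) fun x => (hsub x).deriv
  by_cases hne : ∃ u, IsField V u
  · obtain ⟨u₀, hu₀⟩ := hne
    refine ⟨P u₀ 0 - Q u₀ 0, fun u hu x => ?_⟩
    obtain ⟨w, hw, hw0, hw1⟩ := exists_field_interpolating hc hu₀ hu
    rw [← hP.congr_germ hw hu₀ hw0, ← hQ.congr_germ hw hu₀ hw0, sub_const w hw 0 1,
      hP.congr_germ hw hu hw1, hQ.congr_germ hw hu hw1, sub_const u hu 1 x, add_sub_cancel]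
  · exact ⟨0, fun u hu => (hne ⟨u, hu⟩).elim⟩

end Local

/-! ### The recursion operator -/

section RecursionOperator

variable {N L : ℕ} {V : Set (Coord N)} {η : Matrix (Fin N) (Fin N) ℝ}
  {μ : Matrix (Fin L) (Fin L) ℝ} {ψ : Fin L → Coord N → ℝ} {h h' : Coord N → ℝ}
  {F : Fin L → Coord N → ℝ} {Y Y' G : FieldFun N (Coord N)} {s : ℕ}

theorem rightFactor_eq (hη : η.IsSymm) (ψ : Fin L → Coord N → ℝ) (u ξ : ℝ → Coord N) (n : Fin L)
    (x : ℝ) :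
    rightFactor η ψ u ξ n x = hessForm ψ (u x) (η *ᵥ ξ x) (deriv u x) n := by
  rw [hessForm, mulVec_dotProduct hη, dotProduct]
  simp only [rightFactor, mulVec, dotProduct, Finset.mul_sum, hess, of_apply]
  exact Finset.sum_congr rfl fun j _ => Finset.sum_congr rfl fun r _ =>
    Finset.sum_congr rfl fun s _ => by ring

theorem leftFactor_eq (η : Matrix (Fin N) (Fin N) ℝ) (μ : Matrix (Fin L) (Fin L) ℝ)
    (ψ : Fin L → Coord N → ℝ) (u : ℝ → Coord N) (P : Fin L → ℝ → ℝ) (x : ℝ) :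
    leftFactor η μ ψ u P x =
      η *ᵥ hessComb ψ (u x) (μ *ᵥ fun n => P n x) *ᵥ deriv u x := by
  ext i
  simp only [leftFactor, hessComb, sum_mulVec, smul_mulVec, mulVec_sum, mulVec_smul,
    Finset.sum_apply, Pi.smul_apply, smul_eq_mul]
  simp only [mulVec, dotProduct, Finset.sum_mul, Finset.mul_sum, hess, of_apply]
  exact Finset.sum_congr rfl fun m _ => Finset.sum_comm.trans <| Finset.sum_congr rfl fun p _ =>
    Finset.sum_comm.trans <| Finset.sum_congr rfl fun k _ => Finset.sum_congr rfl fun n _ => by ring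

theorem flow_eq_leftFactor (F : Fin L → Coord N → ℝ) (u : ℝ → Coord N) (x : ℝ) :
    flow η μ ψ F u x = leftFactor η μ ψ u (fun n y => F n (u y)) x := by
  ext i
  simp only [flow, leftFactor]
  exact Finset.sum_congr rfl fun m _ => Finset.sum_congr rfl fun n _ =>
    Finset.sum_congr rfl fun p _ => Finset.sum_congr rfl fun k _ => by ring

/-- `Y = M₂ δH` is the vector field `η^{ij} ∂_j∂_kh u^k_x` on fields with values in `V`, where
`H = ∫ h(u) dx`. -/
def IsHessianFlow (V : Set (Coord N)) (η : Matrix (Fin N) (Fin N) ℝ) (h : Coord N → ℝ)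
    (Y : FieldFun N (Coord N)) : Prop :=
  ∀ u, IsField V u → ∀ x, Y u x = η *ᵥ hess h (u x) *ᵥ deriv u x

theorem SolvesH.flow_eq (hh : SolvesH V μ ψ F h') {u : ℝ → Coord N} {x : ℝ} (hx : u x ∈ V) :
    flow η μ ψ F u x = η *ᵥ hess h' (u x) *ᵥ deriv u x := by
  rw [flow_eq_leftFactor, leftFactor_eq, hh.hess_eq hx]

theorem SolvesH.isHessianFlow (hh : SolvesH V μ ψ F h') :
    IsHessianFlow V η h' (flow η μ ψ F) := fun _ hu x => hh.flow_eq (hu.2 x)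

theorem isHessianFlow_of_hess_eq_inv (hη : η.det ≠ 0) (hh : ∀ u ∈ V, hess h u = η⁻¹)
    (hY : ∀ u, IsField V u → ∀ x, Y u x = deriv u x) : IsHessianFlow V η h Y := fun u hu x => by
  rw [hY u hu, hh _ (hu.2 x), mulVec_mulVec, mul_nonsing_inv η hη.isUnit, one_mulVec]

theorem IsHessianFlow.isHydrodynamic (hY : IsHessianFlow V η h Y) (hV : IsOpen V)
    (hh : ContDiffOn ℝ ∞ h V) : IsHydrodynamic V Y := by
  refine ⟨fun i k v => (η * hess h v) i k, fun i k => ?_, fun u hu x i => ?_⟩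
  · simp only [Matrix.mul_apply]
    exact ContDiffOn.sum fun p _ => contDiffOn_const.mul (contDiffOn_hess hV hh p k)
  · rw [hY u hu, mulVec_mulVec]
    rfl

theorem isTotalDeriv_varDeriv (hV : IsOpen V) (hh : ContDiffOn ℝ ∞ h V) :
    IsTotalDeriv V (varDeriv h) fun u x => hess h (u x) *ᵥ deriv u x := fun u hu x =>
  (hu.hasDerivAt_comp hV (contDiffOn_grad hV hh) x).congr_deriv
    (fderiv_grad_apply hV hh (hu.2 x) (deriv u x))

theorem IsHessianFlow.isM2Value (hY : IsHessianFlow V η h Y) (hV : IsOpen V)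
    (hh : ContDiffOn ℝ ∞ h V) : IsM2Value V η (varDeriv h) Y := fun u hu x =>
  hY u hu x ▸ hasDerivAt_mulVec η (isTotalDeriv_varDeriv hV hh u hu x)

theorem SolvesF.isInvDx (hF : SolvesF V η ψ h F) (hη : η.IsSymm) (hV : IsOpen V)
    (hG : ∀ u, IsField V u → ∀ x, G u x = grad h (u x)) (n : Fin L) :
    IsInvDx V (fun u x => rightFactor η ψ u (G u) n x) (fun u x => F n (u x)) :=
  isInvDx_comp hV (hF.1 n) fun u hu x => by
    rw [rightFactor_eq hη, hG u hu, ← hF.fderiv_eq hV (hu.2 x),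
      fderiv_pi fun n => differentiableAt_of_contDiffOn hV (hF.1 n) (hu.2 x),
      ContinuousLinearMap.pi_apply]

theorem SolvesF.isM1Value (hF : SolvesF V η ψ h F) (hη : η.IsSymm) (hV : IsOpen V)
    (hG : ∀ u, IsField V u → ∀ x, G u x = grad h (u x)) :
    IsM1Value V η μ ψ G (flow η μ ψ F) :=
  ⟨fun n u x => F n (u x), hF.isInvDx hη hV hG, fun u _ x => flow_eq_leftFactor F u x⟩

theorem IsM1Value.exists_solvesF (hY : IsM1Value V η μ ψ G Y) (hη : η.IsSymm) (hV : IsOpen V)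
    (hc : Convex ℝ V) (hF : SolvesF V η ψ h F)
    (hG : ∀ u, IsField V u → ∀ x, G u x = grad h (u x)) :
    ∃ F', SolvesF V η ψ h F' ∧ ∀ u, IsField V u → ∀ x, Y u x = flow η μ ψ F' u x := by
  obtain ⟨P, hP, hY⟩ := hY
  choose c P_eq using fun n => (hP n).1.eq_add_const (isLocal_comp (hF.1 n)) hc (hP n).2
    (hF.isInvDx hη hV hG n).2
  refine ⟨_, hF.add_const c, fun u hu x => ?_⟩
  simp only [hY u hu, flow_eq_leftFactor, leftFactor_eq, P_eq _ u hu]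

theorem IsRValue.exists_isHessianFlow (hYY' : IsRValue V η μ ψ Y Y') (hη : η.IsSymm)
    (hη' : η.det ≠ 0) (hμ : μ.IsSymm) (hV : IsOpen V) (hc : Convex ℝ V)
    (hψ : ∀ n, ContDiffOn ℝ ∞ (ψ n) V) (hcomm : CommutingHessians V η ψ)
    (hgauss : GaussEquations V μ ψ) (hh : Admissible V η ψ h) (hY : IsHessianFlow V η h Y) :
    ∃ h', Admissible V η ψ h' ∧ IsHessianFlow V η h' Y' := by
  obtain ⟨G, hG, hGY, hGY'⟩ := hYY'
  have deriv_G : IsTotalDeriv V G fun u x => hess h (u x) *ᵥ deriv u x := fun u hu x => by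
    simpa only [hY u hu, mulVec_mulVec, ← Matrix.mul_assoc, nonsing_inv_mul η hη'.isUnit,
      Matrix.one_mul, one_mulVec] using hasDerivAt_mulVec η⁻¹ (hGY u hu x)
  obtain ⟨c, G_eq⟩ := hG.eq_add_const (isLocal_comp (contDiffOn_grad hV hh.1)) hc deriv_G
    (isTotalDeriv_varDeriv hV hh.1)
  obtain ⟨g, hg, grad_g⟩ := hh.exists_grad_eq_add hV c
  obtain ⟨F, hF⟩ := hg.exists_solvesF hη hV hc hψ
  obtain ⟨F', hF', Y'_eq⟩ := hGY'.exists_solvesF hη hV hc hF fun u hu x => by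
    rw [G_eq u hu, grad_g _ (hu.2 x)]
  obtain ⟨h', hh'⟩ := hF'.exists_solvesH hμ hV hc hψ hgauss
  exact ⟨h', hh'.admissible hcomm, fun u hu x => by rw [Y'_eq u hu, hh'.isHessianFlow u hu]⟩

theorem IsRPowValue.exists_isHessianFlow (hY : IsRPowValue V η μ ψ s Y) (hη : η.IsSymm)
    (hη' : η.det ≠ 0) (hμ : μ.IsSymm) (hV : IsOpen V) (hc : Convex ℝ V)
    (hψ : ∀ n, ContDiffOn ℝ ∞ (ψ n) V) (hcomm : CommutingHessians V η ψ)
    (hgauss : GaussEquations V μ ψ) :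
    ∃ h, Admissible V η ψ h ∧ IsHessianFlow V η h Y := by
  induction s generalizing Y with
  | zero => exact ⟨_, admissible_quadDensity_inv hη hη',
      isHessianFlow_of_hess_eq_inv hη' (fun u _ => hess_quadDensity (IsSymm.inv hη) u) hY⟩
  | succ s ih =>
    obtain ⟨Y₀, hY₀, hR⟩ := hY
    obtain ⟨h, hh, hflow⟩ := ih hY₀
    exact hR.exists_isHessianFlow hη hη' hμ hV hc hψ hcomm hgauss hh hflow

theorem IsHessianFlow.isRValue_flow (hY : IsHessianFlow V η h Y) (hη : η.IsSymm) (hV : IsOpen V)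
    (hh : ContDiffOn ℝ ∞ h V) (hF : SolvesF V η ψ h F) : IsRValue V η μ ψ Y (flow η μ ψ F) :=
  ⟨varDeriv h, isLocal_comp (contDiffOn_grad hV hh), hY.isM2Value hV hh,
    hF.isM1Value hη hV fun _ _ _ => rfl⟩

theorem IsRPowValue.exists_isRValue (hY : IsRPowValue V η μ ψ s Y) (hη : η.IsSymm)
    (hη' : η.det ≠ 0) (hμ : μ.IsSymm) (hV : IsOpen V) (hc : Convex ℝ V)
    (hψ : ∀ n, ContDiffOn ℝ ∞ (ψ n) V) (hcomm : CommutingHessians V η ψ)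
    (hgauss : GaussEquations V μ ψ) : ∃ Y', IsRValue V η μ ψ Y Y' := by
  obtain ⟨h, hh, hflow⟩ := hY.exists_isHessianFlow hη hη' hμ hV hc hψ hcomm hgauss
  obtain ⟨F, hF⟩ := hh.exists_solvesF hη hV hc hψ
  exact ⟨_, hflow.isRValue_flow hη hV hh.1 hF⟩

theorem exists_isRPowValue (hη : η.IsSymm) (hη' : η.det ≠ 0) (hμ : μ.IsSymm) (hV : IsOpen V)
    (hc : Convex ℝ V) (hψ : ∀ n, ContDiffOn ℝ ∞ (ψ n) V) (hcomm : CommutingHessians V η ψ)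
    (hgauss : GaussEquations V μ ψ) : ∀ s, ∃ Y, IsRPowValue V η μ ψ s Y
  | 0 => ⟨fun u x => deriv u x, fun _ _ _ => rfl⟩
  | s + 1 => by
    obtain ⟨Y, hY⟩ := exists_isRPowValue hη hη' hμ hV hc hψ hcomm hgauss s
    obtain ⟨Y', hY'⟩ := hY.exists_isRValue hη hη' hμ hV hc hψ hcomm hgauss
    exact ⟨Y', Y, hY, hY'⟩

theorem SolvesRecursion.isRPowValue {F : ℕ → Fin L → Coord N → ℝ} {h : ℕ → Coord N → ℝ}
    (hs : SolvesRecursion V η μ ψ F h) (hη : η.IsSymm) (hη' : η.det ≠ 0) (hV : IsOpen V)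
    (h1 : 1 ≤ s) : IsRPowValue V η μ ψ s (flow η μ ψ (F s)) := by
  induction s, h1 using Nat.le_induction with
  | base =>
    have hflow : IsHessianFlow V η (h 1) fun u x => deriv u x :=
      isHessianFlow_of_hess_eq_inv hη' (fun u hu => (hs 0).hess_one_eq hη hV hu) fun _ _ _ => rfl
    have smooth_h : ContDiffOn ℝ ∞ (h 1) V :=
      (contDiff_quadDensity _).contDiffOn.congr (hs 0).eqOn_quadDensity
    exact ⟨_, fun _ _ _ => rfl, hflow.isRValue_flow hη hV smooth_h (hs.solvesF le_rfl)⟩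
  | succ s h1 ih =>
    have hh := hs.solvesH h1
    exact ⟨_, ih, hh.isHessianFlow.isRValue_flow hη hV hh.1 (hs.solvesF (by omega))⟩

end RecursionOperator

/-! ### Commuting flows and densities in involution -/

section Involution

variable {N L : ℕ} {V : Set (Coord N)} {η : Matrix (Fin N) (Fin N) ℝ}
  {μ : Matrix (Fin L) (Fin L) ℝ} {ψ : Fin L → Coord N → ℝ} {f g h : Coord N → ℝ}
  {F G : Fin L → Coord N → ℝ}

theorem SolvesH.hasDerivAt_flow (hf : SolvesH V μ ψ F f) (hV : IsOpen V) {u v : ℝ → Coord N}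
    (hu : IsField V u) {x : ℝ} (hv : DifferentiableAt ℝ v x) :
    HasDerivAt (fun ε : ℝ => flow η μ ψ F (u + ε • v) x)
      (η *ᵥ deriv (fun y => hess f (u y) *ᵥ v y) x) 0 := by
  have linearized := hasDerivAt_mulVec η <| hasDerivAt_fderiv_comp_add_smul hV
    (contDiffOn_grad hV hf.1) (hu.differentiableAt x) hv (hu.2 x)
  simp only [fderiv_grad_apply hV hf.1 (hu.2 _)] at linearized
  have mem_V : ∀ᶠ ε : ℝ in 𝓝 0, (u + ε • v) x ∈ V := by
    have hcont : Continuous fun ε : ℝ => u x + ε • v x := by fun_prop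
    exact hcont.continuousAt.eventually_mem (hV.mem_nhds (by simpa using hu.2 x))
  refine linearized.congr_of_eventuallyEq ?_
  filter_upwards [mem_V] with ε hε
  rw [hf.flow_eq hε, fderiv_grad_apply hV hf.1 hε]

theorem SolvesH.differentiableAt_flow (hf : SolvesH V μ ψ F f) (hV : IsOpen V) {u : ℝ → Coord N}
    (hu : IsField V u) (x : ℝ) : DifferentiableAt ℝ (flow η μ ψ F u) x := by
  have flow_eq : flow η μ ψ F u = fun y => η *ᵥ fderiv ℝ (grad f) (u y) (deriv u y) :=
    funext fun y => by rw [hf.flow_eq (hu.2 y), fderiv_grad_apply hV hf.1 (hu.2 y)]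
  have hgrad := (differentiableAt_fderiv_of_contDiffOn hV (contDiffOn_grad hV hf.1)
    (hu.2 x)).comp x (hu.differentiableAt x)
  have hderiv := hgrad.clm_apply (hu.contDiff_deriv.differentiable (by simp) x)
  exact flow_eq ▸ (hasDerivAt_mulVec η hderiv.hasDerivAt).differentiableAt

theorem SolvesH.flowsCommute (hf : SolvesH V μ ψ F f) (hg : SolvesH V μ ψ G g) (hV : IsOpen V)
    (hfg : HessCommute V η f g) : FlowsCommute V (flow η μ ψ F) (flow η μ ψ G) := by
  intro u hu x
  refine ⟨_, hf.hasDerivAt_flow hV hu (hg.differentiableAt_flow hV hu x), ?_⟩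
  convert hg.hasDerivAt_flow hV hu (hf.differentiableAt_flow hV hu x) using 4 with y
  rw [hf.flow_eq (hu.2 y), hg.flow_eq (hu.2 y)]
  simp only [mulVec_mulVec, ← Matrix.mul_assoc, hfg _ (hu.2 y)]

theorem HessCommute.inInvolution_isM2Value (hhg : HessCommute V η h g) (hη : η.IsSymm)
    (hV : IsOpen V) (hc : Convex ℝ V) (hh : ContDiffOn ℝ ∞ h V) (hg : ContDiffOn ℝ ∞ g V) :
    InInvolution V (IsM2Value V η) h g := by
  have hval : IsM2Value V η (varDeriv g) fun u x => η *ᵥ hess g (u x) *ᵥ deriv u x :=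
    IsHessianFlow.isM2Value (fun _ _ _ => rfl) hV hg
  refine ⟨⟨_, hval⟩, fun Y hY => ?_⟩
  obtain ⟨Q, hQ, hdQ⟩ := hhg.exists_potential hη hV hc hh hg
  refine ⟨_, isInvDx_comp hV hQ fun u hu x => ?_⟩
  rw [hdQ _ (hu.2 x), (hY u hu x).unique (hval u hu x)]
  rfl

/-- The density of `{∫ h dx, ∫ g dx}₁` is `μ^{mn} ∂ₓF_m G_n`, a closed form along `u` by the Gauss
equations. -/
theorem SolvesF.inInvolution_isM1Value (hF : SolvesF V η ψ h F) (hG : SolvesF V η ψ g G)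
    (hη : η.IsSymm) (hμ : μ.IsSymm) (hV : IsOpen V) (hc : Convex ℝ V)
    (hψ : ∀ n, ContDiffOn ℝ ∞ (ψ n) V) (hgauss : GaussEquations V μ ψ) :
    InInvolution V (IsM1Value V η μ ψ) h g := by
  refine ⟨⟨_, hG.isM1Value hη hV fun _ _ _ => rfl⟩, fun Y hY => ?_⟩
  obtain ⟨G', hG', Y_eq⟩ := hY.exists_solvesF hη hV hc hG fun _ _ _ => rfl
  obtain ⟨Q, hQ, hdQ⟩ := exists_fderiv_eq_dotProduct_mulVec hV hc μ (contDiffOn_pi.2 hG'.1)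
    (contDiffOn_pi.2 hF.1) fun u hu x y => by
      rw [hG'.fderiv_eq hV hu, hF.fderiv_eq hV hu, hG'.fderiv_eq hV hu, hF.fderiv_eq hV hu,
        hessForm_comm hV hψ hu (η *ᵥ grad h u) y, hgauss.hessForm_swap hu,
        hessForm_comm hV hψ hu x, dotProduct_mulVec_comm hμ]
  refine ⟨_, isInvDx_comp hV hQ fun u hu x => ?_⟩
  calc ∑ i, varDeriv h u x i * Y u x i
      = grad h (u x) ⬝ᵥ flow η μ ψ G' u x := by rw [← Y_eq u hu]; rfl
    _ = (μ *ᵥ fun n => G' n (u x)) ⬝ᵥ hessForm ψ (u x) (η *ᵥ grad h (u x)) (deriv u x) := by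
      rw [flow_eq_leftFactor, leftFactor_eq, ← mulVec_dotProduct hη, dotProduct_hessComb_mulVec]
    _ = fderiv ℝ Q (u x) (deriv u x) := by
      rw [hdQ _ (hu.2 x), hF.fderiv_eq hV (hu.2 x), mulVec_dotProduct hμ]

end Involution

/-! ### The skew-symmetric antiderivative -/

section SkewInt

variable {ι κ : Type*}

/-- The kernel `½ sign (x - y)` of `skewInt`. -/
noncomputable def skewKernel (z : ℝ × ℝ) : ℝ :=
  if z.2 < z.1 then 1 / 2 else if z.1 < z.2 then -(1 / 2) else 0

theorem measurable_skewKernel : Measurable skewKernel :=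
  Measurable.ite (measurableSet_lt measurable_snd measurable_fst) measurable_const
    (Measurable.ite (measurableSet_lt measurable_fst measurable_snd) measurable_const
      measurable_const)

theorem norm_skewKernel_le (z : ℝ × ℝ) : ‖skewKernel z‖ ≤ 1 := by
  unfold skewKernel
  split_ifs <;> norm_num

theorem skewKernel_swap (z : ℝ × ℝ) : skewKernel z.swap = -skewKernel z := by
  unfold skewKernel
  rcases lt_trichotomy z.1 z.2 with h | h | h
  · simp [h, h.not_gt]
  · simp [h]
  · simp [h, h.not_gt]

theorem integrable_skewKernel_mul {g : ℝ → ℝ} (hg : Integrable g) (x : ℝ) :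
    Integrable fun y => skewKernel (x, y) * g y :=
  hg.bdd_mul (measurable_skewKernel.comp measurable_prodMk_left).aestronglyMeasurable
    (Eventually.of_forall fun _ => norm_skewKernel_le _)

theorem skewInt_eq_integral {g : ℝ → ℝ} (hg : Integrable g) (x : ℝ) :
    skewInt g x = ∫ y, skewKernel (x, y) * g y := by
  rw [← integral_add_compl measurableSet_Iic (integrable_skewKernel_mul hg x) (s := Iic x),
    compl_Iic, integral_Iic_eq_integral_Iio, setIntegral_congr_fun measurableSet_Iio
      (g := fun y => (1 / 2) * g y) fun y (hy : y < x) => by simp [skewKernel, hy],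
    setIntegral_congr_fun measurableSet_Ioi
      (g := fun y => (-(1 / 2)) * g y) fun y (hy : x < y) => by simp [skewKernel, hy, hy.not_gt],
    integral_const_mul, integral_const_mul, skewInt, integral_Iic_eq_integral_Iio]
  ring

theorem hasDerivAt_skewInt {g : ℝ → ℝ} (hg : Integrable g) (hc : Continuous g) (x : ℝ) :
    HasDerivAt (skewInt g) (g x) x := by
  have skewInt_eq : skewInt g =
      fun x => (∫ y in (0 : ℝ)..x, g y) + ((∫ y in Iic 0, g y) - (1 / 2) * ∫ y, g y) := by
    ext x
    have split_at_x := integral_add_compl (measurableSet_Iic (a := x)) hg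
    have split_at_zero := intervalIntegral.integral_Iic_sub_Iic (hg.integrableOn (s := Iic 0))
      (hg.integrableOn (s := Iic x))
    rw [compl_Iic] at split_at_x
    rw [skewInt, ← split_at_x, ← split_at_zero]
    ring
  rw [skewInt_eq]
  exact (intervalIntegral.integral_hasDerivAt_right (hc.intervalIntegrable _ _)
    hc.stronglyMeasurable.stronglyMeasurableAtFilter hc.continuousAt).add_const _

/-- `skewInt` applied to each component of a vector-valued function. -/
noncomputable def skewPrimitive (f : ℝ → ι → ℝ) (x : ℝ) : ι → ℝ :=
  fun i => skewInt (fun y => f y i) x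

theorem hasDerivAt_skewPrimitive [Fintype ι] {f : ℝ → ι → ℝ} (hf : Integrable f)
    (hc : Continuous f) (x : ℝ) : HasDerivAt (skewPrimitive f) (f x) x :=
  hasDerivAt_pi.2 fun i => hasDerivAt_skewInt (hf.eval i) (continuous_pi_iff.1 hc i) x

theorem contDiff_skewPrimitive [Fintype ι] {f : ℝ → ι → ℝ} (hf : ContDiff ℝ ∞ f)
    (hs : HasCompactSupport f) : ContDiff ℝ ∞ (skewPrimitive f) := by
  have h := hasDerivAt_skewPrimitive (hf.continuous.integrable_of_hasCompactSupport hs)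
    hf.continuous
  rw [contDiff_infty_iff_deriv]
  exact ⟨fun x => (h x).differentiableAt, by rwa [deriv_eq h]⟩

variable [Fintype ι] [Fintype κ] (M : Matrix ι κ ℝ) {f : ℝ → ι → ℝ} {g : ℝ → κ → ℝ}

theorem integrable_skewKernel_mul_dotProduct (hf : Integrable f) (hg : Integrable g) :
    Integrable (fun z : ℝ × ℝ => skewKernel z * (f z.1 ⬝ᵥ M *ᵥ g z.2)) := by
  refine Integrable.bdd_mul ?_ measurable_skewKernel.aestronglyMeasurable
    (Eventually.of_forall norm_skewKernel_le)
  simp only [dotProduct, mulVec, Finset.mul_sum]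
  exact integrable_finsetSum _ fun i _ => integrable_finsetSum _ fun j _ =>
    (hf.eval i).mul_prod ((hg.eval j).const_mul (M i j))

theorem dotProduct_mulVec_skewPrimitive (hg : Integrable g) (a : ι → ℝ) (x : ℝ) :
    a ⬝ᵥ M *ᵥ skewPrimitive g x = ∫ y, skewKernel (x, y) * (a ⬝ᵥ M *ᵥ g y) := by
  have component : ∀ j, Integrable fun y => (a ᵥ* M) j * (skewKernel (x, y) * g y j) := fun j =>
    (integrable_skewKernel_mul (hg.eval j) x).const_mul _
  calc a ⬝ᵥ M *ᵥ skewPrimitive g x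
      = ∑ j, ∫ y, (a ᵥ* M) j * (skewKernel (x, y) * g y j) := by
        rw [Matrix.dotProduct_mulVec]
        refine Finset.sum_congr rfl fun j _ => ?_
        rw [integral_const_mul, ← skewInt_eq_integral (hg.eval j), skewPrimitive]
    _ = ∫ y, skewKernel (x, y) * (a ⬝ᵥ M *ᵥ g y) := by
        rw [← integral_finsetSum _ fun j _ => component j]
        refine integral_congr_ae (Eventually.of_forall fun y => ?_)
        simp only [Matrix.dotProduct_mulVec a, mul_left_comm _ (skewKernel _), ← Finset.mul_sum]
        rfl

theorem integrable_dotProduct_mulVec_skewPrimitive (hf : Integrable f) (hg : Integrable g) :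
    Integrable fun x => f x ⬝ᵥ M *ᵥ skewPrimitive g x := by
  simp only [dotProduct_mulVec_skewPrimitive M hg]
  exact (integrable_skewKernel_mul_dotProduct M hf hg).integral_prod_left

theorem integral_dotProduct_mulVec_skewPrimitive (hf : Integrable f) (hg : Integrable g) :
    ∫ x, f x ⬝ᵥ M *ᵥ skewPrimitive g x =
      ∫ z : ℝ × ℝ, skewKernel z * (f z.1 ⬝ᵥ M *ᵥ g z.2) := by
  simp only [dotProduct_mulVec_skewPrimitive M hg]
  exact (integral_prod _ (integrable_skewKernel_mul_dotProduct M hf hg)).symm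

theorem integral_dotProduct_mulVec_skewPrimitive_comm {M : Matrix ι ι ℝ} (hM : M.IsSymm)
    {g : ℝ → ι → ℝ} (hf : Integrable f) (hg : Integrable g) :
    ∫ x, f x ⬝ᵥ M *ᵥ skewPrimitive g x = -∫ x, g x ⬝ᵥ M *ᵥ skewPrimitive f x := by
  rw [integral_dotProduct_mulVec_skewPrimitive M hf hg,
    integral_dotProduct_mulVec_skewPrimitive M hg hf, ← integral_neg, Measure.volume_eq_prod,
    ← integral_prod_swap]
  refine integral_congr_ae (Eventually.of_forall fun z => ?_)
  simp only [skewKernel_swap, Prod.fst_swap, Prod.snd_swap, dotProduct_mulVec_comm hM (f z.2),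
    neg_mul]

end SkewInt

/-! ### Differentiation under the integral sign -/

theorem integrable_of_continuousOn_of_eq_zero {X E : Type*} [TopologicalSpace X] [T2Space X]
    [MeasurableSpace X] [OpensMeasurableSpace X] {ν : Measure X} [IsFiniteMeasureOnCompacts ν]
    [NormedAddCommGroup E] {f : X → E} {K : Set X} (hK : IsCompact K) (hf : ContinuousOn f K)
    (h0 : ∀ x ∉ K, f x = 0) : Integrable f ν :=
  (integrableOn_iff_integrable_of_support_subset fun x hx => by
    by_contra hxK; exact hx (h0 x hxK)).1 (hf.integrableOn_compact hK)

section TestFamily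

variable {X Y E : Type*} [NormedAddCommGroup X] [NormedSpace ℝ X] [NormedAddCommGroup Y]
  [NormedSpace ℝ Y] [NormedAddCommGroup E] [NormedSpace ℝ E]

theorem hasDerivAt_fst_of_contDiffAt {ρ : ℝ × X → E} {ε : ℝ} {x : X}
    (h : ContDiffAt ℝ 1 ρ (ε, x)) :
    HasDerivAt (fun ε => ρ (ε, x)) (fderiv ℝ ρ (ε, x) (1, 0)) ε :=
  (h.differentiableAt one_ne_zero).hasFDerivAt.comp_hasDerivAt ε
    ((hasDerivAt_id ε).prodMk (hasDerivAt_const ε x))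

/-- `ρ (ε, ·)` is a family of functions supported in the compact set `K`, continuously
differentiable for `ε` near `0`, and `ρ'` is its `ε`-derivative at `0`. -/
structure IsTestFamily (K : Set X) (ρ : ℝ × X → E) (ρ' : X → E) : Prop where
  isCompact : IsCompact K
  contDiffAt : ∀ x ∈ K, ContDiffAt ℝ 1 ρ (0, x)
  eq_zero : ∀ ε, ∀ x ∉ K, ρ (ε, x) = 0
  hasDerivAt : ∀ x, HasDerivAt (fun ε => ρ (ε, x)) (ρ' x) 0

namespace IsTestFamily

variable {K : Set X} {ρ : ℝ × X → E} {ρ' : X → E}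

theorem deriv_eq_zero (hρ : IsTestFamily K ρ ρ') {x : X} (hx : x ∉ K) : ρ' x = 0 :=
  (hρ.hasDerivAt x).unique <| by
    simpa only [hρ.eq_zero _ x hx] using hasDerivAt_const (0 : ℝ) (0 : E)

theorem exists_eventually_norm_fderiv_le (hρ : IsTestFamily K ρ ρ') :
    ∃ B, ∀ᶠ ε in 𝓝 (0 : ℝ), ∀ x ∈ K,
      ContDiffAt ℝ 1 ρ (ε, x) ∧ ‖fderiv ℝ ρ (ε, x)‖ ≤ B := by
  have fderiv_continuousAt : ∀ x ∈ K, ContinuousAt (fderiv ℝ ρ) (0, x) := fun x hx =>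
    (hρ.contDiffAt x hx).continuousAt_fderiv one_ne_zero
  obtain ⟨B, hB⟩ := hρ.isCompact.exists_bound_of_continuousOn (f := fun x => fderiv ℝ ρ (0, x))
    fun x hx => ((fderiv_continuousAt x hx).comp (x := x) (by fun_prop)).continuousWithinAt
  refine ⟨B + 1, hρ.isCompact.eventually_forall_of_forall_eventually fun x hx => ?_⟩
  filter_upwards [(hρ.contDiffAt x hx).eventually (by simp),
    (fderiv_continuousAt x hx).norm.eventually_lt continuousAt_const
      ((hB x hx).trans_lt (lt_add_one B))] with z hz hzB using ⟨hz, hzB.le⟩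

variable [MeasurableSpace X] [BorelSpace X] {ν : Measure X} [IsFiniteMeasureOnCompacts ν]

theorem eventually_integrable (hρ : IsTestFamily K ρ ρ') :
    ∀ᶠ ε in 𝓝 (0 : ℝ), Integrable (fun x => ρ (ε, x)) ν := by
  obtain ⟨B, hB⟩ := hρ.exists_eventually_norm_fderiv_le
  filter_upwards [hB] with ε hε
  exact integrable_of_continuousOn_of_eq_zero hρ.isCompact (fun x hx =>
    ((hε x hx).1.continuousAt.comp (x := x) (by fun_prop)).continuousWithinAt) (hρ.eq_zero ε)

theorem integrable_deriv (hρ : IsTestFamily K ρ ρ') : Integrable ρ' ν := by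
  refine integrable_of_continuousOn_of_eq_zero hρ.isCompact (ContinuousOn.congr (fun x hx => ?_)
    fun x hx => (hρ.hasDerivAt x).unique (hasDerivAt_fst_of_contDiffAt (hρ.contDiffAt x hx)))
    fun x hx => hρ.deriv_eq_zero hx
  exact ((((hρ.contDiffAt x hx).continuousAt_fderiv one_ne_zero).comp (x := x)
    (f := fun x => ((0 : ℝ), x)) (by fun_prop)).clm_apply continuousAt_const).continuousWithinAt

theorem hasDerivAt_integral_mul {Φ : ℝ × X → ℝ} {Φ' : X → ℝ} (hΦ : IsTestFamily K Φ Φ')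
    {k : X → ℝ} {C : ℝ} (hk : AEStronglyMeasurable k ν) (hkC : ∀ x, ‖k x‖ ≤ C) :
    HasDerivAt (fun ε => ∫ x, k x * Φ (ε, x) ∂ν) (∫ x, k x * Φ' x ∂ν) 0 := by
  obtain ⟨B, hB⟩ := hΦ.exists_eventually_norm_fderiv_le
  set bound : X → ℝ := K.indicator fun _ => B * ‖((1 : ℝ), (0 : X))‖ with bound_def
  have deriv_bound : ∀ᶠ ε in 𝓝 (0 : ℝ), ∀ x,
      DifferentiableAt ℝ (fun ε => Φ (ε, x)) ε ∧ ‖deriv (fun ε => Φ (ε, x)) ε‖ ≤ bound x := by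
    filter_upwards [hB] with ε hε x
    by_cases hx : x ∈ K
    · have h := hasDerivAt_fst_of_contDiffAt (hε x hx).1
      rw [h.deriv, bound_def, indicator_of_mem hx]
      exact ⟨h.differentiableAt, (fderiv ℝ Φ (ε, x)).le_of_opNorm_le (hε x hx).2 _⟩
    · simp [bound, hΦ.eq_zero _ x hx, hx]
  have bound_integrable : Integrable bound ν := (integrable_indicator_iff
    hΦ.isCompact.measurableSet).2 (integrableOn_const hΦ.isCompact.measure_lt_top.ne)
  have deriv_zero : ∀ x, deriv (fun ε => Φ (ε, x)) 0 = Φ' x := fun x => (hΦ.hasDerivAt x).deriv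
  have key := hasDerivAt_integral_of_dominated_loc_of_deriv_le (μ := ν)
    (F := fun ε x => k x * Φ (ε, x)) (F' := fun ε x => k x * deriv (fun ε => Φ (ε, x)) ε)
    (bound := fun x => C * bound x) deriv_bound
    (hΦ.eventually_integrable.mono fun ε hε => hk.mul hε.1)
    (hΦ.eventually_integrable.self_of_nhds.bdd_mul hk (Eventually.of_forall hkC))
    (by simpa only [deriv_zero] using hk.fun_mul hΦ.integrable_deriv.1)
    (Eventually.of_forall fun x ε hε => norm_mul_le_of_le (hkC x) (hε x).2)
    (bound_integrable.const_mul C)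
    (Eventually.of_forall fun x ε hε => (hε x).1.hasDerivAt.const_mul (k x))
  simpa only [deriv_zero] using key.2

end IsTestFamily

variable {ι : Type*} [Fintype ι]

theorem IsTestFamily.dotProduct_mulVec (M : Matrix ι ι ℝ) {K : Set X} {K' : Set Y}
    {ρ : ℝ × X → ι → ℝ} {ρ' : X → ι → ℝ} {σ : ℝ × Y → ι → ℝ} {σ' : Y → ι → ℝ}
    (hρ : IsTestFamily K ρ ρ') (hσ : IsTestFamily K' σ σ') :
    IsTestFamily (K ×ˢ K') (fun z : ℝ × X × Y => ρ (z.1, z.2.1) ⬝ᵥ M *ᵥ σ (z.1, z.2.2))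
      (fun z => ρ' z.1 ⬝ᵥ M *ᵥ σ (0, z.2) + ρ (0, z.1) ⬝ᵥ M *ᵥ σ' z.2) where
  isCompact := hρ.isCompact.prod hσ.isCompact
  contDiffAt := fun z hz => by
    have ρ_smooth : ContDiffAt ℝ 1 (fun z : ℝ × X × Y => ρ (z.1, z.2.1)) (0, z) :=
      (hρ.contDiffAt z.1 hz.1).comp (0, z) (by fun_prop)
    have σ_smooth : ContDiffAt ℝ 1 (fun z : ℝ × X × Y => M *ᵥ σ (z.1, z.2.2)) (0, z) :=
      M.mulVecLin.toContinuousLinearMap.contDiff.contDiffAt.comp (0, z)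
        ((hσ.contDiffAt z.2 hz.2).comp (0, z) (by fun_prop))
    exact ContDiffAt.sum fun i _ => (contDiffAt_pi.1 ρ_smooth i).mul (contDiffAt_pi.1 σ_smooth i)
  eq_zero := fun ε z hz => by
    rcases not_and_or.1 hz with hz | hz
    · rw [hρ.eq_zero ε _ hz, zero_dotProduct]
    · rw [hσ.eq_zero ε _ hz, mulVec_zero, dotProduct_zero]
  hasDerivAt := fun z =>
    hasDerivAt_dotProduct (hρ.hasDerivAt z.1) (hasDerivAt_mulVec M (hσ.hasDerivAt z.2))

theorem IsTestFamily.hasDerivAt_integral_skewPrimitive {M : Matrix ι ι ℝ} (hM : M.IsSymm)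
    {K K' : Set ℝ} {ρ σ : ℝ × ℝ → ι → ℝ} {ρ' σ' : ℝ → ι → ℝ} (hρ : IsTestFamily K ρ ρ')
    (hσ : IsTestFamily K' σ σ') :
    HasDerivAt (fun ε => ∫ x, ρ (ε, x) ⬝ᵥ M *ᵥ skewPrimitive (fun y => σ (ε, y)) x)
      ((∫ x, ρ' x ⬝ᵥ M *ᵥ skewPrimitive (fun y => σ (0, y)) x) -
        ∫ x, σ' x ⬝ᵥ M *ᵥ skewPrimitive (fun y => ρ (0, y)) x) 0 := by
  have ρ₀_integrable : Integrable fun x => ρ (0, x) := hρ.eventually_integrable.self_of_nhds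
  have σ₀_integrable : Integrable fun x => σ (0, x) := hσ.eventually_integrable.self_of_nhds
  have ρ'_integrable : Integrable ρ' := hρ.integrable_deriv
  have σ'_integrable : Integrable σ' := hσ.integrable_deriv
  rw [sub_eq_add_neg,
    ← integral_dotProduct_mulVec_skewPrimitive_comm hM ρ₀_integrable σ'_integrable,
    integral_dotProduct_mulVec_skewPrimitive M ρ'_integrable σ₀_integrable,
    integral_dotProduct_mulVec_skewPrimitive M ρ₀_integrable σ'_integrable,
    ← integral_add (integrable_skewKernel_mul_dotProduct M ρ'_integrable σ₀_integrable)
      (integrable_skewKernel_mul_dotProduct M ρ₀_integrable σ'_integrable)]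
  simp only [← mul_add]
  refine ((hρ.dotProduct_mulVec M hσ).hasDerivAt_integral_mul
    measurable_skewKernel.aestronglyMeasurable norm_skewKernel_le).congr_of_eventuallyEq ?_
  filter_upwards [hρ.eventually_integrable (ν := volume),
    hσ.eventually_integrable (ν := volume)] with ε hε hε'
  exact integral_dotProduct_mulVec_skewPrimitive M hε hε'

end TestFamily

/-! ### Hamiltonian operators -/

section TestFunctions

variable {N : ℕ} {η : Matrix (Fin N) (Fin N) ℝ} {ξ ζ : ℝ → Coord N}

theorem IsTest.mulVec (hξ : IsTest ξ) (A : Matrix (Fin N) (Fin N) ℝ) :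
    IsTest fun x => A *ᵥ ξ x :=
  ⟨A.mulVecLin.toContinuousLinearMap.contDiff.comp hξ.1,
    hξ.2.comp_left (g := fun a => A *ᵥ a) (mulVec_zero A)⟩

theorem IsTest.deriv (hξ : IsTest ξ) : IsTest (deriv ξ) :=
  ⟨(contDiff_infty_iff_deriv.1 hξ.1).2, hξ.2.deriv⟩

theorem IsTest.hasDerivAt (hξ : IsTest ξ) (x : ℝ) : HasDerivAt ξ (_root_.deriv ξ x) x :=
  (hξ.1.differentiable (by simp) x).hasDerivAt

theorem IsTest.integrable_dotProduct (hξ : IsTest ξ) (hζ : Continuous ζ) :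
    Integrable fun x => ξ x ⬝ᵥ ζ x :=
  (hξ.1.continuous.dotProduct hζ).integrable_of_hasCompactSupport
    (HasCompactSupport.intro hξ.2 fun x hx => by
      rw [image_eq_zero_of_notMem_tsupport hx, zero_dotProduct])

theorem IsTest.integrable_dotProduct_M2op (η : Matrix (Fin N) (Fin N) ℝ) (hξ : IsTest ξ)
    (hζ : IsTest ζ) : Integrable fun x => ξ x ⬝ᵥ M2op η ζ x :=
  hξ.integrable_dotProduct (hζ.deriv.mulVec η).1.continuous

theorem IsTest.integral_dotProduct_M2op_comm (hη : η.IsSymm) (hξ : IsTest ξ) (hζ : IsTest ζ) :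
    ∫ x, ξ x ⬝ᵥ M2op η ζ x = -∫ x, ζ x ⬝ᵥ M2op η ξ x := by
  have hξζ := hξ.integrable_dotProduct_M2op η hζ
  have hζξ := hζ.integrable_dotProduct_M2op η hξ
  rw [eq_neg_iff_add_eq_zero, ← integral_add hξζ hζξ]
  refine integral_eq_zero_of_hasDerivAt_of_integrable (f := fun x => ξ x ⬝ᵥ η *ᵥ ζ x)
    (fun x => ?_) (hξζ.add hζξ) (hξ.integrable_dotProduct (hζ.mulVec η).1.continuous)
  refine (hasDerivAt_dotProduct (hξ.hasDerivAt x)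
    (hasDerivAt_mulVec η (hζ.hasDerivAt x))).congr_deriv ?_
  rw [dotProduct_mulVec_comm hη, add_comm]
  rfl

end TestFunctions

section NonlocalOperator

variable {N L : ℕ} {U : Set (Coord N)} {η : Matrix (Fin N) (Fin N) ℝ}
  {μ : Matrix (Fin L) (Fin L) ℝ} {ψ : Fin L → Coord N → ℝ} {u v ξ ζ : ℝ → Coord N}

theorem contDiffOn_hessForm {X : Type*} [NormedAddCommGroup X] [NormedSpace ℝ X] {s : Set X}
    (hU : IsOpen U) (hψ : ∀ n, ContDiffOn ℝ ∞ (ψ n) U) {p a b : X → Coord N}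
    (hp : ContDiffOn ℝ ∞ p s) (hpU : MapsTo p s U) (ha : ContDiffOn ℝ ∞ a s)
    (hb : ContDiffOn ℝ ∞ b s) : ContDiffOn ℝ ∞ (fun z => hessForm ψ (p z) (a z) (b z)) s :=
  contDiffOn_pi.2 fun n => contDiffOn_dotProduct ha <| contDiffOn_pi.2 fun i =>
    contDiffOn_dotProduct
      (contDiffOn_pi.2 fun j => (contDiffOn_hess hU (hψ n) i j).comp hp hpU) hb

/-- The functions `η^{jr} ∂_r ∂_s ψ_n u^s_x ξ_j` to which `M₁` applies `(d/dx)⁻¹`. -/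
noncomputable def rightVector (η : Matrix (Fin N) (Fin N) ℝ) (ψ : Fin L → Coord N → ℝ)
    (u ξ : ℝ → Coord N) (x : ℝ) : Fin L → ℝ :=
  hessForm ψ (u x) (η *ᵥ ξ x) (deriv u x)

/-- The derivative of `rightVector η ψ u ξ` with respect to the field `u`, in the direction `v`. -/
noncomputable def rightVariation (η : Matrix (Fin N) (Fin N) ℝ) (ψ : Fin L → Coord N → ℝ)
    (u v ξ : ℝ → Coord N) (x : ℝ) : Fin L → ℝ :=
  fun n => (η *ᵥ ξ x) ⬝ᵥ deriv (fun y => hess (ψ n) (u y) *ᵥ v y) x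

/-- The matrix `A` with `M₁ ξ = η A u_x`: the combination of the Hessians of the `ψ_m` with the
nonlocal coefficients `μ^{mn} (d/dx)⁻¹ (rightVector η ψ u ξ)_n`. -/
noncomputable def nonlocalHess (η : Matrix (Fin N) (Fin N) ℝ) (μ : Matrix (Fin L) (Fin L) ℝ)
    (ψ : Fin L → Coord N → ℝ) (u ξ : ℝ → Coord N) (x : ℝ) : Matrix (Fin N) (Fin N) ℝ :=
  hessComb ψ (u x) (μ *ᵥ skewPrimitive (rightVector η ψ u ξ) x)

theorem M1op_eq (hη : η.IsSymm) (μ : Matrix (Fin L) (Fin L) ℝ) (ψ : Fin L → Coord N → ℝ)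
    (u ξ : ℝ → Coord N) (x : ℝ) :
    M1op η μ ψ u ξ x = η *ᵥ nonlocalHess η μ ψ u ξ x *ᵥ deriv u x := by
  have : (fun n => skewInt (rightFactor η ψ u ξ n) x) =
      skewPrimitive (rightVector η ψ u ξ) x :=
    funext fun n => congrArg (skewInt · x) (funext (rightFactor_eq hη ψ u ξ n))
  rw [M1op, leftFactor_eq, this, nonlocalHess]

theorem dotProduct_nonlocalHess_mulVec (a b : Coord N) (x : ℝ) :
    a ⬝ᵥ nonlocalHess η μ ψ u ξ x *ᵥ b =
      hessForm ψ (u x) a b ⬝ᵥ μ *ᵥ skewPrimitive (rightVector η ψ u ξ) x := by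
  rw [nonlocalHess, dotProduct_hessComb_mulVec, dotProduct_comm]

theorem rightVector_eq_zero (u : ℝ → Coord N) {x : ℝ} (hx : x ∉ tsupport ξ) :
    rightVector η ψ u ξ x = 0 := by
  ext n
  rw [rightVector, hessForm, image_eq_zero_of_notMem_tsupport hx, mulVec_zero, zero_dotProduct,
    Pi.zero_apply]

theorem contDiff_rightVector (hU : IsOpen U) (hψ : ∀ n, ContDiffOn ℝ ∞ (ψ n) U)
    (hu : IsField U u) (hξ : IsTest ξ) : ContDiff ℝ ∞ (rightVector η ψ u ξ) :=
  contDiffOn_univ.1 <| contDiffOn_hessForm hU hψ hu.1.contDiffOn (fun x _ => hu.2 x)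
    (hξ.mulVec η).1.contDiffOn hu.contDiff_deriv.contDiffOn

theorem hasCompactSupport_rightVector (u : ℝ → Coord N) (hξ : IsTest ξ) :
    HasCompactSupport (rightVector η ψ u ξ) :=
  HasCompactSupport.intro hξ.2 fun _ => rightVector_eq_zero u

theorem integrable_rightVector (hU : IsOpen U) (hψ : ∀ n, ContDiffOn ℝ ∞ (ψ n) U)
    (hu : IsField U u) (hξ : IsTest ξ) : Integrable (rightVector η ψ u ξ) :=
  (contDiff_rightVector hU hψ hu hξ).continuous.integrable_of_hasCompactSupport
    (hasCompactSupport_rightVector u hξ)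

theorem contDiff_nonlocalHess_mulVec (hU : IsOpen U) (hψ : ∀ n, ContDiffOn ℝ ∞ (ψ n) U)
    (hu : IsField U u) (hξ : IsTest ξ) (hv : ContDiff ℝ ∞ v) :
    ContDiff ℝ ∞ fun x => nonlocalHess η μ ψ u ξ x *ᵥ v x := by
  have primitive_smooth := contDiff_skewPrimitive (contDiff_rightVector (η := η) hU hψ hu hξ)
    (hasCompactSupport_rightVector u hξ)
  refine contDiff_pi.2 fun i => ?_
  simp only [← single_one_dotProduct i (_ *ᵥ _), dotProduct_nonlocalHess_mulVec]
  exact contDiffOn_univ.1 <| contDiffOn_dotProduct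
    (contDiffOn_hessForm hU hψ hu.1.contDiffOn (fun x _ => hu.2 x) contDiffOn_const hv.contDiffOn)
    (contDiffOn_mulVec μ primitive_smooth.contDiffOn)

theorem contDiffAt_rightVector_add_smul (hU : IsOpen U) (hψ : ∀ n, ContDiffOn ℝ ∞ (ψ n) U)
    (hu : IsField U u) (hv : ContDiff ℝ ∞ v) (hξ : IsTest ξ) (x : ℝ) :
    ContDiffAt ℝ ∞ (fun z : ℝ × ℝ => rightVector η ψ (u + z.1 • v) ξ z.2) (0, x) := by
  have hdv : ∀ x, DifferentiableAt ℝ v x := hv.differentiable (by simp)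
  have deriv_perturbed : ∀ z : ℝ × ℝ, deriv (u + z.1 • v) z.2 =
      deriv u z.2 + z.1 • deriv v z.2 := fun z => by
    rw [deriv_add (hu.differentiableAt _) ((hdv _).const_smul z.1), deriv_const_smul z.1 (hdv _)]
  have hp : ContDiff ℝ ∞ fun z : ℝ × ℝ => (u + z.1 • v) z.2 :=
    (hu.1.comp contDiff_snd).add (contDiff_fst.smul (hv.comp contDiff_snd))
  have hb : ContDiff ℝ ∞ fun z : ℝ × ℝ => deriv u z.2 + z.1 • deriv v z.2 :=
    (hu.contDiff_deriv.comp contDiff_snd).add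
      (contDiff_fst.smul ((contDiff_infty_iff_deriv.1 hv).2.comp contDiff_snd))
  simp only [rightVector, deriv_perturbed]
  exact (contDiffOn_hessForm hU hψ hp.contDiffOn (mapsTo_preimage _ U)
    ((hξ.mulVec η).1.comp contDiff_snd).contDiffOn hb.contDiffOn).contDiffAt
    ((hU.preimage hp.continuous).mem_nhds (by simpa using hu.2 x))

theorem hasDerivAt_rightVector_add_smul (hU : IsOpen U) (hψ : ∀ n, ContDiffOn ℝ ∞ (ψ n) U)
    (hu : IsField U u) (η : Matrix (Fin N) (Fin N) ℝ) (ξ : ℝ → Coord N) {x : ℝ}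
    (hv : DifferentiableAt ℝ v x) :
    HasDerivAt (fun ε : ℝ => rightVector η ψ (u + ε • v) ξ x) (rightVariation η ψ u v ξ x) 0 := by
  refine hasDerivAt_pi.2 fun n => ?_
  have hdgrad := hasDerivAt_fderiv_comp_add_smul hU (contDiffOn_grad hU (hψ n))
    (hu.differentiableAt x) hv (hu.2 x)
  simp only [fun y => fderiv_grad_apply hU (hψ n) (hu.2 y)] at hdgrad
  have perturbed_mem : ∀ᶠ ε in 𝓝 (0 : ℝ), (u + ε • v) x ∈ U :=
    ContinuousAt.eventually_mem (f := fun ε : ℝ => u x + ε • v x) (by fun_prop)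
      (hU.mem_nhds (by simpa using hu.2 x))
  refine ((hasDerivAt_dotProduct (hasDerivAt_const 0 (η *ᵥ ξ x)) hdgrad).congr_deriv
    (by rw [zero_dotProduct, zero_add]; rfl)).congr_of_eventuallyEq ?_
  filter_upwards [perturbed_mem] with ε hε
  rw [fderiv_grad_apply hU (hψ n) hε]
  rfl

theorem isTestFamily_rightVector (hU : IsOpen U) (hψ : ∀ n, ContDiffOn ℝ ∞ (ψ n) U)
    (hu : IsField U u) (hv : ContDiff ℝ ∞ v) (hξ : IsTest ξ) :
    IsTestFamily (tsupport ξ) (fun z => rightVector η ψ (u + z.1 • v) ξ z.2)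
      (rightVariation η ψ u v ξ) where
  isCompact := hξ.2
  contDiffAt := fun x _ =>
    (contDiffAt_rightVector_add_smul hU hψ hu hv hξ x).of_le (by exact_mod_cast le_top)
  eq_zero := fun _ _ => rightVector_eq_zero _
  hasDerivAt := fun x =>
    hasDerivAt_rightVector_add_smul hU hψ hu η ξ (hv.differentiable (by simp) x)

end NonlocalOperator

section Bracket

variable {N L : ℕ} {U : Set (Coord N)} {η : Matrix (Fin N) (Fin N) ℝ}
  {μ : Matrix (Fin L) (Fin L) ℝ} {ψ : Fin L → Coord N → ℝ} {u v ξ ζ : ℝ → Coord N}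

theorem pairing_eq (hη : η.IsSymm) (hξ : IsTest ξ) (hζ : IsTest ζ)
    (hrξ : Integrable (rightVector η ψ u ξ)) (hrζ : Integrable (rightVector η ψ u ζ)) (a b : ℝ) :
    pairing ξ (a • M1op η μ ψ u ζ + b • M2op η ζ) =
      a * (∫ x, rightVector η ψ u ξ x ⬝ᵥ μ *ᵥ skewPrimitive (rightVector η ψ u ζ) x) +
        b * ∫ x, ξ x ⬝ᵥ M2op η ζ x := by
  have density : ∀ x, ξ x ⬝ᵥ (a • M1op η μ ψ u ζ x + b • M2op η ζ x) =
      a * (rightVector η ψ u ξ x ⬝ᵥ μ *ᵥ skewPrimitive (rightVector η ψ u ζ) x) +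
        b * (ξ x ⬝ᵥ M2op η ζ x) := fun x => by
    rw [dotProduct_add, dotProduct_smul, dotProduct_smul, smul_eq_mul, smul_eq_mul, M1op_eq hη,
      ← mulVec_dotProduct hη, dotProduct_nonlocalHess_mulVec, rightVector]
  rw [← integral_const_mul, ← integral_const_mul, ← integral_add
    ((integrable_dotProduct_mulVec_skewPrimitive μ hrξ hrζ).const_mul a)
    ((hξ.integrable_dotProduct_M2op η hζ).const_mul b)]
  exact integral_congr_ae (Eventually.of_forall density)

theorem pairing_comm (hη : η.IsSymm) (hμ : μ.IsSymm) (hU : IsOpen U)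
    (hψ : ∀ n, ContDiffOn ℝ ∞ (ψ n) U) (hu : IsField U u) (hξ : IsTest ξ) (hζ : IsTest ζ)
    (a b : ℝ) :
    pairing ξ (a • M1op η μ ψ u ζ + b • M2op η ζ) =
      -pairing ζ (a • M1op η μ ψ u ξ + b • M2op η ξ) := by
  have hrξ := integrable_rightVector (η := η) hU hψ hu hξ
  have hrζ := integrable_rightVector (η := η) hU hψ hu hζ
  rw [pairing_eq hη hξ hζ hrξ hrζ, pairing_eq hη hζ hξ hrζ hrξ,
    hξ.integral_dotProduct_M2op_comm hη hζ,
    integral_dotProduct_mulVec_skewPrimitive_comm hμ hrξ hrζ]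
  ring

theorem hasDerivAt_dotProduct_nonlocalHess (hη : η.IsSymm) (hU : IsOpen U)
    (hψ : ∀ n, ContDiffOn ℝ ∞ (ψ n) U) (μ : Matrix (Fin L) (Fin L) ℝ) (hu : IsField U u)
    (hv : ContDiff ℝ ∞ v) (hξ : IsTest ξ) (hζ : IsTest ζ) (x : ℝ) :
    HasDerivAt (fun x => ξ x ⬝ᵥ η *ᵥ nonlocalHess η μ ψ u ζ x *ᵥ v x)
      (deriv ξ x ⬝ᵥ η *ᵥ nonlocalHess η μ ψ u ζ x *ᵥ v x +
        rightVariation η ψ u v ξ x ⬝ᵥ μ *ᵥ skewPrimitive (rightVector η ψ u ζ) x +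
        hessForm ψ (u x) (η *ᵥ ξ x) (v x) ⬝ᵥ μ *ᵥ hessForm ψ (u x) (η *ᵥ ζ x) (deriv u x)) x := by
  have hess_smooth : ∀ n, ContDiff ℝ ∞ fun y => hess (ψ n) (u y) *ᵥ v y := fun n =>
    contDiff_pi.2 fun i => contDiffOn_univ.1 <| contDiffOn_dotProduct (contDiffOn_pi.2 fun j =>
      ((contDiffOn_hess hU (hψ n) i j).comp_contDiff hu.1 hu.2).contDiffOn) hv.contDiffOn
  have form_deriv : HasDerivAt (fun x => hessForm ψ (u x) (η *ᵥ ξ x) (v x))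
      (hessForm ψ (u x) (η *ᵥ deriv ξ x) (v x) + rightVariation η ψ u v ξ x) x :=
    hasDerivAt_pi.2 fun n => hasDerivAt_dotProduct (hasDerivAt_mulVec η (hξ.hasDerivAt x))
      ((hess_smooth n).differentiable (by simp) x).hasDerivAt
  have primitive_deriv := hasDerivAt_skewPrimitive (integrable_rightVector (η := η) hU hψ hu hζ)
    (contDiff_rightVector hU hψ hu hζ).continuous x
  simp only [← mulVec_dotProduct hη, dotProduct_nonlocalHess_mulVec, ← add_dotProduct]
  exact hasDerivAt_dotProduct form_deriv (hasDerivAt_mulVec μ primitive_deriv)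

theorem integrable_dotProduct_nonlocalHess (hU : IsOpen U) (hψ : ∀ n, ContDiffOn ℝ ∞ (ψ n) U)
    (hu : IsField U u) (hv : ContDiff ℝ ∞ v) (hξ : IsTest ξ) (hζ : IsTest ζ) :
    Integrable fun x => ξ x ⬝ᵥ η *ᵥ nonlocalHess η μ ψ u ζ x *ᵥ v x :=
  hξ.integrable_dotProduct (contDiffOn_univ.1 (contDiffOn_mulVec η
    (contDiff_nonlocalHess_mulVec hU hψ hu hζ hv).contDiffOn)).continuous

theorem integrable_rightVariation_dotProduct (hU : IsOpen U) (hψ : ∀ n, ContDiffOn ℝ ∞ (ψ n) U)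
    (hu : IsField U u) (hv : ContDiff ℝ ∞ v) (hξ : IsTest ξ) (hζ : IsTest ζ) :
    Integrable fun x =>
      rightVariation η ψ u v ξ x ⬝ᵥ μ *ᵥ skewPrimitive (rightVector η ψ u ζ) x :=
  integrable_dotProduct_mulVec_skewPrimitive μ
    (isTestFamily_rightVector hU hψ hu hv hξ).integrable_deriv (integrable_rightVector hU hψ hu hζ)

/-- The density, up to the factor `a`, of the derivative along `v` of the bracket `{I_ξ, I_ζ}`
defined by `a M₁ + b M₂`. -/
noncomputable def bracketVariation (η : Matrix (Fin N) (Fin N) ℝ) (μ : Matrix (Fin L) (Fin L) ℝ)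
    (ψ : Fin L → Coord N → ℝ) (u v ξ ζ : ℝ → Coord N) (x : ℝ) : ℝ :=
  deriv ζ x ⬝ᵥ η *ᵥ nonlocalHess η μ ψ u ξ x *ᵥ v x -
    deriv ξ x ⬝ᵥ η *ᵥ nonlocalHess η μ ψ u ζ x *ᵥ v x

theorem integrable_bracketVariation (hU : IsOpen U) (hψ : ∀ n, ContDiffOn ℝ ∞ (ψ n) U)
    (hu : IsField U u) (hv : ContDiff ℝ ∞ v) (hξ : IsTest ξ) (hζ : IsTest ζ) :
    Integrable (bracketVariation η μ ψ u v ξ ζ) :=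
  (integrable_dotProduct_nonlocalHess hU hψ hu hv hζ.deriv hξ).sub
    (integrable_dotProduct_nonlocalHess hU hψ hu hv hξ.deriv hζ)

/-- An integration by parts: the total derivative of `ξ η A_ζ v - ζ η A_ξ v` integrates to zero,
and its terms quadratic in the second fundamental form cancel by the Gauss equations. -/
theorem integral_rightVariation_sub (hη : η.IsSymm) (hU : IsOpen U)
    (hψ : ∀ n, ContDiffOn ℝ ∞ (ψ n) U) (hgauss : GaussEquations U μ ψ) (hu : IsField U u)
    (hv : ContDiff ℝ ∞ v) (hξ : IsTest ξ) (hζ : IsTest ζ) :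
    (∫ x, rightVariation η ψ u v ξ x ⬝ᵥ μ *ᵥ skewPrimitive (rightVector η ψ u ζ) x) -
        ∫ x, rightVariation η ψ u v ζ x ⬝ᵥ μ *ᵥ skewPrimitive (rightVector η ψ u ξ) x =
      ∫ x, bracketVariation η μ ψ u v ξ ζ x := by
  have hrξ := integrable_rightVariation_dotProduct (η := η) (μ := μ) hU hψ hu hv hξ hζ
  have hrζ := integrable_rightVariation_dotProduct (η := η) (μ := μ) hU hψ hu hv hζ hξ
  have hr : Integrable fun x =>
      rightVariation η ψ u v ξ x ⬝ᵥ μ *ᵥ skewPrimitive (rightVector η ψ u ζ) x -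
        rightVariation η ψ u v ζ x ⬝ᵥ μ *ᵥ skewPrimitive (rightVector η ψ u ξ) x := hrξ.sub hrζ
  have variation_integrable := integrable_bracketVariation (η := η) (μ := μ) hU hψ hu hv hξ hζ
  rw [← integral_sub hrξ hrζ, ← sub_eq_zero, ← integral_sub hr variation_integrable]
  refine integral_eq_zero_of_hasDerivAt_of_integrable (f := fun x =>
    ξ x ⬝ᵥ η *ᵥ nonlocalHess η μ ψ u ζ x *ᵥ v x - ζ x ⬝ᵥ η *ᵥ nonlocalHess η μ ψ u ξ x *ᵥ v x)
    (fun x => ?_) (hr.sub variation_integrable)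
    ((integrable_dotProduct_nonlocalHess hU hψ hu hv hξ hζ).sub
      (integrable_dotProduct_nonlocalHess hU hψ hu hv hζ hξ))
  have quadratic_terms_cancel :
      hessForm ψ (u x) (η *ᵥ ξ x) (v x) ⬝ᵥ μ *ᵥ hessForm ψ (u x) (η *ᵥ ζ x) (deriv u x) =
        hessForm ψ (u x) (η *ᵥ ζ x) (v x) ⬝ᵥ μ *ᵥ hessForm ψ (u x) (η *ᵥ ξ x) (deriv u x) := by
    simp only [hessForm_comm hU hψ (hu.2 x) _ (v x)]
    exact hgauss.hessForm_swap (hu.2 x) _ _ _ _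
  refine ((hasDerivAt_dotProduct_nonlocalHess hη hU hψ μ hu hv hξ hζ x).sub
    (hasDerivAt_dotProduct_nonlocalHess hη hU hψ μ hu hv hζ hξ x)).congr_deriv ?_
  rw [quadratic_terms_cancel, bracketVariation]
  ring

theorem hasDerivAt_pairing (hη : η.IsSymm) (hμ : μ.IsSymm) (hU : IsOpen U)
    (hψ : ∀ n, ContDiffOn ℝ ∞ (ψ n) U) (hgauss : GaussEquations U μ ψ) (hu : IsField U u)
    (hv : ContDiff ℝ ∞ v) (hξ : IsTest ξ) (hζ : IsTest ζ) (a b : ℝ) :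
    HasDerivAt (fun ε : ℝ => pairing ξ (a • M1op η μ ψ (u + ε • v) ζ + b • M2op η ζ))
      (a * ∫ x, bracketVariation η μ ψ u v ξ ζ x) 0 := by
  have ξ_family := isTestFamily_rightVector (η := η) hU hψ hu hv hξ
  have ζ_family := isTestFamily_rightVector (η := η) hU hψ hu hv hζ
  have nonlocal_deriv := ξ_family.hasDerivAt_integral_skewPrimitive hμ ζ_family
  simp only [zero_smul, add_zero] at nonlocal_deriv
  rw [integral_rightVariation_sub hη hU hψ hgauss hu hv hξ hζ] at nonlocal_deriv
  refine ((nonlocal_deriv.const_mul a).add_const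
    (b * ∫ x, ξ x ⬝ᵥ M2op η ζ x)).congr_of_eventuallyEq ?_
  filter_upwards [ξ_family.eventually_integrable (ν := volume),
    ζ_family.eventually_integrable (ν := volume)] with ε hεξ hεζ
  exact pairing_eq hη hξ hζ hεξ hεζ a b

theorem contDiff_smul_M1op_add_smul_M2op (hη : η.IsSymm) (hU : IsOpen U)
    (hψ : ∀ n, ContDiffOn ℝ ∞ (ψ n) U) (hu : IsField U u) (hξ : IsTest ξ) (a b : ℝ) :
    ContDiff ℝ ∞ (a • M1op η μ ψ u ξ + b • M2op η ξ) := by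
  refine ContDiff.add (ContDiff.const_smul a ?_) ((hξ.deriv.mulVec η).1.const_smul b)
  simp only [funext (M1op_eq hη μ ψ u ξ)]
  exact contDiffOn_univ.1 (contDiffOn_mulVec η
    (contDiff_nonlocalHess_mulVec hU hψ hu hξ hu.contDiff_deriv).contDiffOn)

theorem cyclic_sum_dotProduct_eq_zero {n : Type*} [Fintype n] {η A₁ A₂ A₃ : Matrix n n ℝ}
    (hη : η.IsSymm) (h₁ : A₁.IsSymm) (h₂ : A₂.IsSymm) (h₃ : A₃.IsSymm)
    (h₁₂ : A₁ * η * A₂ = A₂ * η * A₁) (h₂₃ : A₂ * η * A₃ = A₃ * η * A₂)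
    (h₃₁ : A₃ * η * A₁ = A₁ * η * A₃) (a b : ℝ) (w x₁ x₂ x₃ : n → ℝ) :
    (x₂ ⬝ᵥ η *ᵥ A₁ *ᵥ (a • η *ᵥ A₃ *ᵥ w + b • η *ᵥ x₃) -
        x₁ ⬝ᵥ η *ᵥ A₂ *ᵥ (a • η *ᵥ A₃ *ᵥ w + b • η *ᵥ x₃)) +
      (x₃ ⬝ᵥ η *ᵥ A₂ *ᵥ (a • η *ᵥ A₁ *ᵥ w + b • η *ᵥ x₁) -
        x₂ ⬝ᵥ η *ᵥ A₃ *ᵥ (a • η *ᵥ A₁ *ᵥ w + b • η *ᵥ x₁)) +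
      (x₁ ⬝ᵥ η *ᵥ A₃ *ᵥ (a • η *ᵥ A₂ *ᵥ w + b • η *ᵥ x₂) -
        x₃ ⬝ᵥ η *ᵥ A₁ *ᵥ (a • η *ᵥ A₂ *ᵥ w + b • η *ᵥ x₂)) = 0 := by
  have linear_symm : ∀ {A : Matrix n n ℝ}, A.IsSymm → ∀ x y,
      (η *ᵥ x) ⬝ᵥ A *ᵥ η *ᵥ y = (η *ᵥ y) ⬝ᵥ A *ᵥ η *ᵥ x := fun hA x y =>
    dotProduct_mulVec_comm hA _ _
  have quadratic_comm : ∀ {A B : Matrix n n ℝ}, A * η * B = B * η * A →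
      A *ᵥ η *ᵥ B *ᵥ w = B *ᵥ η *ᵥ A *ᵥ w := fun hAB => by
    simp only [mulVec_mulVec, ← Matrix.mul_assoc, hAB]
  simp only [mulVec_add, mulVec_smul, dotProduct_add, dotProduct_smul, smul_eq_mul,
    ← mulVec_dotProduct hη, linear_symm h₁ x₂ x₃, linear_symm h₂ x₁ x₃, linear_symm h₃ x₂ x₁,
    quadratic_comm h₁₂, quadratic_comm h₂₃, quadratic_comm h₃₁]
  ring

theorem cyclic_sum_bracketVariation_eq_zero (hη : η.IsSymm) (hU : IsOpen U)
    (hψ : ∀ n, ContDiffOn ℝ ∞ (ψ n) U) (hcomm : CommutingHessians U η ψ)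
    (μ : Matrix (Fin L) (Fin L) ℝ) {x : ℝ} (hx : u x ∈ U) (ξ₁ ξ₂ ξ₃ : ℝ → Coord N) (a b : ℝ) :
    bracketVariation η μ ψ u (a • M1op η μ ψ u ξ₃ + b • M2op η ξ₃) ξ₁ ξ₂ x +
      bracketVariation η μ ψ u (a • M1op η μ ψ u ξ₁ + b • M2op η ξ₁) ξ₂ ξ₃ x +
      bracketVariation η μ ψ u (a • M1op η μ ψ u ξ₂ + b • M2op η ξ₂) ξ₃ ξ₁ x = 0 := by
  simp only [bracketVariation, Pi.add_apply, Pi.smul_apply, M1op_eq hη, M2op]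
  exact cyclic_sum_dotProduct_eq_zero hη (hessComb_isSymm hU hψ hx _)
    (hessComb_isSymm hU hψ hx _) (hessComb_isSymm hU hψ hx _) (hcomm.hessComb_mul_comm hx _ _)
    (hcomm.hessComb_mul_comm hx _ _) (hcomm.hessComb_mul_comm hx _ _) a b _ _ _ _

theorem isHamiltonian_smul_M1op_add_smul_M2op (hη : η.IsSymm) (hμ : μ.IsSymm) (hU : IsOpen U)
    (hψ : ∀ n, ContDiffOn ℝ ∞ (ψ n) U) (hcomm : CommutingHessians U η ψ)
    (hgauss : GaussEquations U μ ψ) (a b : ℝ) :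
    IsHamiltonian U fun u ξ => a • M1op η μ ψ u ξ + b • M2op η ξ := by
  refine fun u hu => ⟨fun ξ ζ hξ hζ => pairing_comm hη hμ hU hψ hu hξ hζ a b,
    fun ξ₁ ξ₂ ξ₃ hξ₁ hξ₂ hξ₃ => ?_⟩
  have vector_smooth := fun θ (hθ : IsTest θ) =>
    contDiff_smul_M1op_add_smul_M2op (μ := μ) hη hU hψ hu hθ a b
  have bracket_deriv := fun ξ ζ θ (hξ : IsTest ξ) (hζ : IsTest ζ) (hθ : IsTest θ) =>
    hasDerivAt_pairing hη hμ hU hψ hgauss hu (vector_smooth θ hθ) hξ hζ a b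
  have variation_integrable := fun ξ ζ θ (hξ : IsTest ξ) (hζ : IsTest ζ) (hθ : IsTest θ) =>
    integrable_bracketVariation (η := η) (μ := μ) hU hψ hu (vector_smooth θ hθ) hξ hζ
  have i₁₂ := variation_integrable ξ₁ ξ₂ ξ₃ hξ₁ hξ₂ hξ₃
  have i₂₃ := variation_integrable ξ₂ ξ₃ ξ₁ hξ₂ hξ₃ hξ₁
  have i₃₁ := variation_integrable ξ₃ ξ₁ ξ₂ hξ₃ hξ₁ hξ₂
  refine ⟨_, _, _, bracket_deriv ξ₁ ξ₂ ξ₃ hξ₁ hξ₂ hξ₃, bracket_deriv ξ₂ ξ₃ ξ₁ hξ₂ hξ₃ hξ₁,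
    bracket_deriv ξ₃ ξ₁ ξ₂ hξ₃ hξ₁ hξ₂, ?_⟩
  rw [← mul_add, ← mul_add, ← integral_add i₁₂ i₂₃, ← integral_add (i₁₂.fun_add i₂₃) i₃₁]
  simp only [fun x => cyclic_sum_bracketVariation_eq_zero hη hU hψ hcomm μ (hu.2 x) ξ₁ ξ₂ ξ₃ a b,
    integral_zero, mul_zero]

end Bracket

end HydroHierarchy

open HydroHierarchy in
theorem mainTheorem5_general {N L : ℕ}
    (η : Matrix (Fin N) (Fin N) ℝ) (hη : η.IsSymm) (μ : Matrix (Fin L) (Fin L) ℝ) (hμ : μ.IsSymm)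
    (U : Set (Coord N)) (hU : IsOpen U)
    (ψ : Fin L → Coord N → ℝ) (hψ : ∀ n, ContDiffOn ℝ ∞ (ψ n) U)
    (hcomm : CommutingHessians U η ψ) (hgauss : GaussEquations U μ ψ) :
    (∀ a b : ℝ, IsHamiltonian U (fun u ξ => a • M1op η μ ψ u ξ + b • M2op η ξ)) ∧
    (η.det ≠ 0 → ∀ V ⊆ U, IsOpen V → Convex ℝ V →
      (∀ K F h, SolvesUpTo V η μ ψ K F h →
        (∃ G, SolvesF V η ψ (h (K + 1)) G) ∧
        ∀ G, SolvesF V η ψ (h (K + 1)) G → ∃ g, SolvesH V μ ψ G g) ∧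
      (∃ F h, SolvesRecursion V η μ ψ F h) ∧
      (∀ s, (∃ Y, IsRPowValue V η μ ψ s Y) ∧
        ∀ Y, IsRPowValue V η μ ψ s Y → IsHydrodynamic V Y ∧ ∃ Y', IsRValue V η μ ψ Y Y') ∧
      (∀ F h, SolvesRecursion V η μ ψ F h → ∀ s, 1 ≤ s →
        IsRPowValue V η μ ψ s (flow η μ ψ (F s)) ∧
        IsHydrodynamic V (flow η μ ψ (F s)) ∧
        IsM1Value V η μ ψ (varDeriv (h s)) (flow η μ ψ (F s)) ∧
        IsM2Value V η (varDeriv (h (s + 1))) (flow η μ ψ (F s))) ∧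
      ∀ F h F' h', SolvesRecursion V η μ ψ F h → SolvesRecursion V η μ ψ F' h' →
        ∀ p r, 1 ≤ p → 1 ≤ r →
          FlowsCommute V (flow η μ ψ (F p)) (flow η μ ψ (F' r)) ∧
          InInvolution V (IsM1Value V η μ ψ) (h p) (h' r) ∧
          InInvolution V (IsM2Value V η) (h p) (h' r)) := by
  refine ⟨isHamiltonian_smul_M1op_add_smul_M2op hη hμ hU hψ hcomm hgauss,
    fun hη' V hVU hV hc => ?_⟩
  replace hψ := fun n => (hψ n).mono hVU
  replace hcomm : CommutingHessians V η ψ := fun u hu => hcomm u (hVU hu)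
  replace hgauss : GaussEquations V μ ψ := fun u hu => hgauss u (hVU hu)
  refine ⟨fun K F h hs => ⟨(hs.admissible hη hη' hV hcomm le_rfl).exists_solvesF hη hV hc hψ,
      fun G hG => hG.exists_solvesH hμ hV hc hψ hgauss⟩,
    exists_solvesRecursion hη hη' hμ hV hc hψ hcomm hgauss,
    fun s => ⟨exists_isRPowValue hη hη' hμ hV hc hψ hcomm hgauss s, fun Y hY => ⟨?_,
      hY.exists_isRValue hη hη' hμ hV hc hψ hcomm hgauss⟩⟩,
    fun F h hs s h1 => ?_, fun F h F' h' hs hs' p r hp hr => ?_⟩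
  · obtain ⟨h, hh, hflow⟩ := hY.exists_isHessianFlow hη hη' hμ hV hc hψ hcomm hgauss
    exact hflow.isHydrodynamic hV hh.1
  · have hflow := (hs.solvesH h1).isHessianFlow (η := η)
    have smooth_h := (hs.solvesH h1).1
    exact ⟨hs.isRPowValue hη hη' hV h1, hflow.isHydrodynamic hV smooth_h,
      (hs.solvesF h1).isM1Value hη hV fun _ _ _ => rfl, hflow.isM2Value hV smooth_h⟩
  · have hh := fun {s} => hs.admissible (s := s) hη hη' hV hcomm
    have hh' := fun {s} => hs'.admissible (s := s) hη hη' hV hcomm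
    have hess_commute := fun {p r} (hp : 1 ≤ p) (hr : 1 ≤ r) =>
      hs'.hessCommute hη hη' hV (hh hp) hr
    exact ⟨(hs.solvesH hp).flowsCommute (hs'.solvesH hr) hV (hess_commute (by omega) (by omega)),
      (hs.solvesF hp).inInvolution_isM1Value (hs'.solvesF hr) hη hμ hV hc hψ hgauss,
      (hess_commute hp hr).inInvolution_isM2Value hη hV hc (hh hp).1 (hh' hr).1⟩

open HydroHierarchy in
theorem mainTheorem5 {N L : ℕ}
    (η : Matrix (Fin N) (Fin N) ℝ) (hη : η.IsSymm) (hη' : η.det ≠ 0)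
    (μ : Matrix (Fin L) (Fin L) ℝ) (hμ : μ.IsSymm) (hμ' : μ.det ≠ 0)
    (U : Set (Coord N)) (hU : IsOpen U)
    (ψ : Fin L → Coord N → ℝ) (hψ : ∀ n, ContDiffOn ℝ ∞ (ψ n) U)
    (hcomm : CommutingHessians U η ψ) (hgauss : GaussEquations U μ ψ) :
    -- `M₁` and `M₂` are compatible Hamiltonian operators
    (∀ a b : ℝ, IsHamiltonian U (fun u ξ => a • M1op η μ ψ u ξ + b • M2op η ξ)) ∧
    -- on every convex open part of `U`, hence near every point of `U`:
    ∀ V ⊆ U, IsOpen V → Convex ℝ V →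
      -- every step of the recursion is solvable, whatever choices were made before
      (∀ K F h, SolvesUpTo V η μ ψ K F h →
        (∃ G, SolvesF V η ψ (h (K + 1)) G) ∧
        ∀ G, SolvesF V η ψ (h (K + 1)) G → ∃ g, SolvesH V μ ψ G g) ∧
      (∃ F h, SolvesRecursion V η μ ψ F h) ∧
      -- `R^s u_x` exists as a local expression for every `s`, and is always of hydrodynamic type
      (∀ s, (∃ Y, IsRPowValue V η μ ψ s Y) ∧
        ∀ Y, IsRPowValue V η μ ψ s Y →
          IsHydrodynamic V Y ∧ ∃ Y', IsRValue V η μ ψ Y Y') ∧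
      -- for every solution of the recursion:
      ∀ F h, SolvesRecursion V η μ ψ F h →
        -- the flows are `u_{t_s} = R^s u_x = M₁ δH_s = M₂ δH_{s+1}`
        (∀ s, 1 ≤ s →
          IsRPowValue V η μ ψ s (flow η μ ψ (F s)) ∧
          IsHydrodynamic V (flow η μ ψ (F s)) ∧
          IsM1Value V η μ ψ (varDeriv (h s)) (flow η μ ψ (F s)) ∧
          IsM2Value V η (varDeriv (h (s + 1))) (flow η μ ψ (F s))) ∧
        -- they commute, and the `H_s` are in involution for both brackets
        ∀ p r, 1 ≤ p → 1 ≤ r →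
          FlowsCommute V (flow η μ ψ (F p)) (flow η μ ψ (F r)) ∧
          InInvolution V (IsM1Value V η μ ψ) (h p) (h r) ∧
          InInvolution V (IsM2Value V η) (h p) (h r) := by
  obtain ⟨hamiltonian, hierarchy⟩ := mainTheorem5_general η hη μ hμ U hU ψ hψ hcomm hgauss
  refine ⟨hamiltonian, fun V hVU hV hc => ?_⟩
  obtain ⟨solvable, exist, powers, flows, commute⟩ := hierarchy hη' V hVU hV hc
  exact ⟨solvable, exist, powers, fun F h hs => ⟨flows F h hs, commute F h F h hs hs⟩⟩
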